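/- Let $\mathbb{K}$ be a field, let $A$ be a finite-dimensional $\mathbb{K}$-vector space and let $\Phi : A\otimes A\to A\otimes A$ be a linear map such that $$(\mathrm{Id}\otimes\Phi)\circ(\Phi\otimes\mathrm{Id})\circ(\mathrm{Id}\otimes\Phi)=(\Phi\otimes\mathrm{Id})\circ(\mathrm{Id}\otimes\tau)\circ(\Phi\otimes\mathrm{Id}),$$ where $\tau$ is the flip of $A\otimes A$ (that is, $(A,\Phi)$ is a linear extended associative semigroup). Write $\Phi(a\otimes b)=\sum (a'\rightarrow b')\otimes (a''\triangleright b'')$, and let $\Phi^* : A^*\otimes A^*\to A^*\otimes A^*$ be the transpose of $\Phi$, where $(A\otimes A)^*$ is identified with $A^*\otimes A^*$. Let $\mathbf{As}_\Phi$ be the nonsymmetric operad generated by $A$ in arity two with the relations $a\circ_2 b=\sum (a'\rightarrow b')\circ_1 (a''\triangleright b'')$ for $a,b\in A$; let $\mathbf{As}'_\Phi$ be the nonsymmetric operad generated by $A$ in arity two with the relations $a\circ_1 b=\sum (a'\rightarrow b')\circ_2 (a''\triangleright b'')$ for $a,b\in A$. Let $\mathrm{Sym}\,\mathbf{As}_\Phi$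 be the symmetric operad of $\Phi$-associative algebras: it is generated by binary products $*_a$, linear in $a\in A$ and without symmetry, with the relations $x*_a(y*_b z)=\sum (x*_{a''\triangleright b''}y)*_{a'\rightarrow b'}z$ for $a,b\in A$. The Koszul dual of the binary quadratic nonsymmetric operad $F(E)/(R)$, with $E$ finite-dimensional and $R\subseteq F(E)(3)$, is $F(E^*)/(R^\perp)$, for the pairing of $F(E^*)(3)$ with $F(E)(3)$ given by $\langle f\circ_1 g,a\circ_1 b\rangle=f(a)g(b)$, $\langle f\circ_2 g,a\circ_2 b\rangle=-f(a)g(b)$, $\langle f\circ_1 g,a\circ_2 b\rangle=\langle f\circ_2 g,a\circ_1 b\rangle=0$. The Koszul dual of the binary quadratic symmetric operad $F(E)/(R)$, with $E$ a finite-dimensional representation of $S_2$ and $R\subseteq F(E)(3)$ a subrepresentation of $S_3$, is $F(E^*\otimes\mathrm{sgn})/(R^\perp)$, for the pairing under which the operations $f(g(x_i,x_j),x_k)$ and $a(b(x_{i'},x_{j'}),x_{k'})$, with $(i,j,k)$ and $(i',j',k')$ cyclic permutations of $(1,2,3)$, pair to $f(a)g(b)$ if $k=k'$ and to $0$ otherwise.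 Then: 1. the Koszul dual of the nonsymmetric operad $\mathbf{As}_\Phi$ is isomorphic to $\mathbf{As}'_{\Phi^*}$; 2. the Koszul dual of the nonsymmetric operad $\mathbf{As}'_\Phi$ is isomorphic to $\mathbf{As}_{\Phi^*}$; 3. the Koszul dual of the symmetric operad $\mathrm{Sym}\,\mathbf{As}_\Phi$ is isomorphic to $\mathrm{Sym}\,\mathbf{As}_{\Phi^*}$. -/

import Mathlib

open TensorProduct

universe u v w w'

/-! ## Nonsymmetric operads -/

/-- A nonsymmetric operad in `K`-vector spaces, in the partial definition. Inputs are numbered from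
`0`; `comp i h a b` is the partial composition `a ∘_{i+1} b`, plugging the output of `b` in the input
`i` of `a`. The arity `p` of the result is `m + n - 1`, which is recorded by `h`. -/
structure NSOperad (K : Type u) [Field K] where
  /-- the space of operations with `n` inputs -/
  obj : ℕ → Type w
  [addCommGroup : ∀ n, AddCommGroup (obj n)]
  [module : ∀ n, Module K (obj n)]
  /-- the unit -/
  one : obj 1
  /-- the partial compositions -/
  comp : ∀ {m n p : ℕ} (_i : Fin m) (_h : p + 1 = m + n), obj m →ₗ[K] obj n →ₗ[K] obj p
  one_comp : ∀ {n : ℕ} (h : n + 1 = 1 + n) (a : obj n), comp 0 h one a = a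
  comp_one : ∀ {m : ℕ} (i : Fin m) (h : m + 1 = m + 1) (a : obj m), comp i h a one = a
  /-- sequential composition axiom -/
  comp_seq : ∀ {l m n q r p : ℕ} (i : Fin l) (j : Fin m) (t : Fin q)
    (hq : q + 1 = l + m) (hp : p + 1 = q + n) (hr : r + 1 = m + n) (hp' : p + 1 = l + r)
    (_ : (t : ℕ) = i + j) (a : obj l) (b : obj m) (c : obj n),
    comp t hp (comp i hq a b) c = comp i hp' a (comp j hr b c)
  /-- parallel composition axiom -/
  comp_par : ∀ {l m n q r p : ℕ} (i k : Fin l) (t : Fin q) (i' : Fin r)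
    (hq : q + 1 = l + m) (hp : p + 1 = q + n) (hr : r + 1 = l + n) (hp' : p + 1 = r + m)
    (_ : i < k) (_ : (t : ℕ) + 1 = k + m) (_ : (i' : ℕ) = i) (a : obj l) (b : obj m) (c : obj n),
    comp t hp (comp i hq a b) c = comp i' hp' (comp k hr a c) b

attribute [instance] NSOperad.addCommGroup NSOperad.module

namespace NSOperad

variable {K : Type u} [Field K]

/-- Isomorphisms of nonsymmetric operads. -/
structure Iso (P : NSOperad.{u, w} K) (Q : NSOperad.{u, w'} K) where
  toEquiv : ∀ n, P.obj n ≃ₗ[K] Q.obj n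
  map_one : toEquiv 1 P.one = Q.one
  map_comp : ∀ {m n p : ℕ} (i : Fin m) (h : p + 1 = m + n) (a : P.obj m) (b : P.obj n),
    toEquiv p (P.comp i h a b) = Q.comp i h (toEquiv m a) (toEquiv n b)

/-- Operadic ideals. -/
structure Ideal (P : NSOperad.{u, w} K) where
  carrier : ∀ n, Submodule K (P.obj n)
  comp_mem_left : ∀ {m n p : ℕ} (i : Fin m) (h : p + 1 = m + n) {a : P.obj m} (b : P.obj n),
    a ∈ carrier m → P.comp i h a b ∈ carrier p
  comp_mem_right : ∀ {m n p : ℕ} (i : Fin m) (h : p + 1 = m + n) (a : P.obj m) {b : P.obj n},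
    b ∈ carrier n → P.comp i h a b ∈ carrier p

/-- The smallest operadic ideal containing a set `S` of operations of arity `k`. -/
def Ideal.generate (P : NSOperad.{u, w} K) {k : ℕ} (S : Set (P.obj k)) : P.Ideal where
  carrier n := ⨅ (I : P.Ideal) (_ : S ⊆ I.carrier k), I.carrier n
  comp_mem_left := by
    intro m n p i h a b ha
    simp only [Submodule.mem_iInf] at ha ⊢
    exact fun I hI => I.comp_mem_left i h b (ha I hI)
  comp_mem_right := by
    intro m n p i h a b hb
    simp only [Submodule.mem_iInf] at hb ⊢
    exact fun I hI => I.comp_mem_right i h a (hb I hI)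

/-- The partial compositions of the quotient of an operad by an ideal. -/
def quotComp (P : NSOperad.{u, w} K) (I : P.Ideal) {m n p : ℕ} (i : Fin m) (h : p + 1 = m + n) :
    (P.obj m ⧸ I.carrier m) →ₗ[K] (P.obj n ⧸ I.carrier n) →ₗ[K] (P.obj p ⧸ I.carrier p) :=
  (I.carrier m).liftQ
    { toFun := fun a => (I.carrier n).mapQ (I.carrier p) (P.comp i h a)
        (fun _ hb => I.comp_mem_right i h a hb)
      map_add' := fun a a' => by ext b; simp
      map_smul' := fun c a => by ext b; simp }
    (fun a ha => by
      ext b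
      simpa using I.comp_mem_left i h b ha)

/-- The quotient of a nonsymmetric operad by an operadic ideal. -/
def quot (P : NSOperad.{u, w} K) (I : P.Ideal) : NSOperad.{u, w} K where
  obj n := P.obj n ⧸ I.carrier n
  one := (I.carrier 1).mkQ P.one
  comp i h := P.quotComp I i h
  one_comp h a := by
    induction a using Submodule.Quotient.induction_on with | _ a
    exact congrArg (Submodule.Quotient.mk) (P.one_comp h a)
  comp_one i h a := by
    induction a using Submodule.Quotient.induction_on with | _ a
    exact congrArg (Submodule.Quotient.mk) (P.comp_one i h a)
  comp_seq i j t hq hp hr hp' ht a b c := by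
    induction a using Submodule.Quotient.induction_on with | _ a
    induction b using Submodule.Quotient.induction_on with | _ b
    induction c using Submodule.Quotient.induction_on with | _ c
    exact congrArg (Submodule.Quotient.mk) (P.comp_seq i j t hq hp hr hp' ht a b c)
  comp_par i k t i' hq hp hr hp' hik ht hi' a b c := by
    induction a using Submodule.Quotient.induction_on with | _ a
    induction b using Submodule.Quotient.induction_on with | _ b
    induction c using Submodule.Quotient.induction_on with | _ c
    exact congrArg (Submodule.Quotient.mk) (P.comp_par i k t i' hq hp hr hp' hik ht hi' a b c)

end NSOperad

/-! ### The free nonsymmetric operad on a space of binary generators -/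

/-- Formal operadic expressions in binary generators from `E`. -/
inductive NSTerm (K : Type u) (E : Type v) : ℕ → Type (max u v)
  | zero (n : ℕ) : NSTerm K E n
  | add {n : ℕ} (x y : NSTerm K E n) : NSTerm K E n
  | smul {n : ℕ} (c : K) (x : NSTerm K E n) : NSTerm K E n
  | one : NSTerm K E 1
  | gen (e : E) : NSTerm K E 2
  | comp {m n p : ℕ} (i : Fin m) (h : p + 1 = m + n) (x : NSTerm K E m) (y : NSTerm K E n) :
      NSTerm K E p

/-- The smallest congruence on formal expressions that makes them a nonsymmetric operad in vector
spaces, in which the generators depend linearly on `e : E`. -/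
inductive NSTerm.Rel (K : Type u) [Field K] (E : Type v) [AddCommGroup E] [Module K E] :
    ∀ {n : ℕ}, NSTerm K E n → NSTerm K E n → Prop
  -- equivalence relation, compatible with the operations
  | refl {n : ℕ} (x : NSTerm K E n) : Rel K E x x
  | symm {n : ℕ} {x y : NSTerm K E n} : Rel K E x y → Rel K E y x
  | trans {n : ℕ} {x y z : NSTerm K E n} : Rel K E x y → Rel K E y z → Rel K E x z
  | add_congr {n : ℕ} {x x' y y' : NSTerm K E n} :
      Rel K E x x' → Rel K E y y' → Rel K E (.add x y) (.add x' y')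
  | smul_congr {n : ℕ} (c : K) {x x' : NSTerm K E n} :
      Rel K E x x' → Rel K E (.smul c x) (.smul c x')
  | comp_congr {m n p : ℕ} (i : Fin m) (h : p + 1 = m + n) {x x' : NSTerm K E m}
      {y y' : NSTerm K E n} :
      Rel K E x x' → Rel K E y y' → Rel K E (.comp i h x y) (.comp i h x' y')
  -- vector space axioms
  | add_assoc {n : ℕ} (x y z : NSTerm K E n) :
      Rel K E (.add (.add x y) z) (.add x (.add y z))
  | add_comm {n : ℕ} (x y : NSTerm K E n) : Rel K E (.add x y) (.add y x)
  | zero_add {n : ℕ} (x : NSTerm K E n) : Rel K E (.add (.zero n) x) x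
  | smul_add {n : ℕ} (c : K) (x y : NSTerm K E n) :
      Rel K E (.smul c (.add x y)) (.add (.smul c x) (.smul c y))
  | add_smul {n : ℕ} (c d : K) (x : NSTerm K E n) :
      Rel K E (.smul (c + d) x) (.add (.smul c x) (.smul d x))
  | mul_smul {n : ℕ} (c d : K) (x : NSTerm K E n) :
      Rel K E (.smul (c * d) x) (.smul c (.smul d x))
  | one_smul {n : ℕ} (x : NSTerm K E n) : Rel K E (.smul 1 x) x
  | zero_smul {n : ℕ} (x : NSTerm K E n) : Rel K E (.smul 0 x) (.zero n)
  -- linearity of the generators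
  | gen_add (e f : E) : Rel K E (.gen (e + f)) (.add (.gen e) (.gen f))
  | gen_smul (c : K) (e : E) : Rel K E (.gen (c • e)) (.smul c (.gen e))
  -- bilinearity of the partial compositions
  | add_comp {m n p : ℕ} (i : Fin m) (h : p + 1 = m + n) (x x' : NSTerm K E m)
      (y : NSTerm K E n) :
      Rel K E (.comp i h (.add x x') y) (.add (.comp i h x y) (.comp i h x' y))
  | smul_comp {m n p : ℕ} (i : Fin m) (h : p + 1 = m + n) (c : K) (x : NSTerm K E m)
      (y : NSTerm K E n) :
      Rel K E (.comp i h (.smul c x) y) (.smul c (.comp i h x y))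
  | comp_add {m n p : ℕ} (i : Fin m) (h : p + 1 = m + n) (x : NSTerm K E m)
      (y y' : NSTerm K E n) :
      Rel K E (.comp i h x (.add y y')) (.add (.comp i h x y) (.comp i h x y'))
  | comp_smul {m n p : ℕ} (i : Fin m) (h : p + 1 = m + n) (c : K) (x : NSTerm K E m)
      (y : NSTerm K E n) :
      Rel K E (.comp i h x (.smul c y)) (.smul c (.comp i h x y))
  -- operad axioms
  | one_comp {n : ℕ} (h : n + 1 = 1 + n) (x : NSTerm K E n) : Rel K E (.comp 0 h .one x) x
  | comp_one {m : ℕ} (i : Fin m) (h : m + 1 = m + 1) (x : NSTerm K E m) :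
      Rel K E (.comp i h x .one) x
  | comp_seq {l m n q r p : ℕ} (i : Fin l) (j : Fin m) (t : Fin q)
      (hq : q + 1 = l + m) (hp : p + 1 = q + n) (hr : r + 1 = m + n) (hp' : p + 1 = l + r)
      (ht : (t : ℕ) = i + j) (x : NSTerm K E l) (y : NSTerm K E m) (z : NSTerm K E n) :
      Rel K E (.comp t hp (.comp i hq x y) z) (.comp i hp' x (.comp j hr y z))
  | comp_par {l m n q r p : ℕ} (i k : Fin l) (t : Fin q) (i' : Fin r)
      (hq : q + 1 = l + m) (hp : p + 1 = q + n) (hr : r + 1 = l + n) (hp' : p + 1 = r + m)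
      (hik : i < k) (ht : (t : ℕ) + 1 = k + m) (hi' : (i' : ℕ) = i)
      (x : NSTerm K E l) (y : NSTerm K E m) (z : NSTerm K E n) :
      Rel K E (.comp t hp (.comp i hq x y) z) (.comp i' hp' (.comp k hr x z) y)

section NSFree

variable (K : Type u) [Field K] (E : Type v) [AddCommGroup E] [Module K E]

/-- The congruence on formal expressions, as a setoid. -/
def NSTerm.setoid (n : ℕ) : Setoid (NSTerm K E n) :=
  ⟨NSTerm.Rel K E, NSTerm.Rel.refl, NSTerm.Rel.symm, NSTerm.Rel.trans⟩

/-- The arity `n` component of the free nonsymmetric operad generated by `E` in arity two. -/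
def NSFreeObj (n : ℕ) : Type (max u v) := Quotient (NSTerm.setoid K E n)

instance NSFreeObj.instZero (n : ℕ) : Zero (NSFreeObj K E n) :=
  ⟨Quotient.mk _ (NSTerm.zero n)⟩

instance NSFreeObj.instAdd (n : ℕ) : Add (NSFreeObj K E n) :=
  ⟨Quotient.map₂ NSTerm.add (fun _ _ h _ _ h' => NSTerm.Rel.add_congr h h')⟩

instance NSFreeObj.instNeg (n : ℕ) : Neg (NSFreeObj K E n) :=
  ⟨Quotient.map (NSTerm.smul (-1)) (fun _ _ h => NSTerm.Rel.smul_congr _ h)⟩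

instance NSFreeObj.instAddCommGroup (n : ℕ) : AddCommGroup (NSFreeObj K E n) where
  add_assoc a b c := by
    induction a, b, c using Quotient.inductionOn₃ with | _ a b c
    exact Quotient.sound (NSTerm.Rel.add_assoc a b c)
  add_comm a b := by
    induction a, b using Quotient.inductionOn₂ with | _ a b
    exact Quotient.sound (NSTerm.Rel.add_comm a b)
  zero_add a := by
    induction a using Quotient.inductionOn with | _ a
    exact Quotient.sound (NSTerm.Rel.zero_add a)
  add_zero a := by
    induction a using Quotient.inductionOn with | _ a
    exact Quotient.sound ((NSTerm.Rel.add_comm _ _).trans (NSTerm.Rel.zero_add a))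
  nsmul := nsmulRec
  zsmul := zsmulRec
  neg_add_cancel a := by
    induction a using Quotient.inductionOn with | _ a
    refine Quotient.sound (?_ : NSTerm.Rel K E (.add (.smul (-1) a) a) (.zero n))
    refine ((NSTerm.Rel.refl _).add_congr (NSTerm.Rel.one_smul a).symm).trans ?_
    refine (NSTerm.Rel.add_smul (-1) 1 a).symm.trans ?_
    rw [neg_add_cancel]
    exact NSTerm.Rel.zero_smul a

instance NSFreeObj.instModule (n : ℕ) : Module K (NSFreeObj K E n) where
  smul c := Quotient.map (NSTerm.smul c) (fun _ _ h => NSTerm.Rel.smul_congr _ h)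
  one_smul a := by
    induction a using Quotient.inductionOn with | _ a
    exact Quotient.sound (NSTerm.Rel.one_smul a)
  mul_smul c d a := by
    induction a using Quotient.inductionOn with | _ a
    exact Quotient.sound (NSTerm.Rel.mul_smul c d a)
  smul_add c a b := by
    induction a, b using Quotient.inductionOn₂ with | _ a b
    exact Quotient.sound (NSTerm.Rel.smul_add c a b)
  add_smul c d a := by
    induction a using Quotient.inductionOn with | _ a
    exact Quotient.sound (NSTerm.Rel.add_smul c d a)
  zero_smul a := by
    induction a using Quotient.inductionOn with | _ a
    exact Quotient.sound (NSTerm.Rel.zero_smul a)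
  smul_zero c := by
    refine Quotient.sound (?_ : NSTerm.Rel K E (.smul c (.zero n)) (.zero n))
    refine (NSTerm.Rel.smul_congr c (NSTerm.Rel.zero_smul (.zero n)).symm).trans ?_
    refine (NSTerm.Rel.mul_smul c 0 _).symm.trans ?_
    rw [mul_zero]
    exact NSTerm.Rel.zero_smul _

/-- The free nonsymmetric operad generated by the vector space `E`, placed in arity two. -/
def NSFree : NSOperad.{u, max u v} K where
  obj := NSFreeObj K E
  one := Quotient.mk _ NSTerm.one
  comp i h := LinearMap.mk₂ K
    (Quotient.map₂ (NSTerm.comp i h) (fun _ _ hx _ _ hy => NSTerm.Rel.comp_congr i h hx hy))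
    (fun a a' b => by
      induction a, a', b using Quotient.inductionOn₃ with | _ a a' b
      exact Quotient.sound (NSTerm.Rel.add_comp i h a a' b))
    (fun c a b => by
      induction a, b using Quotient.inductionOn₂ with | _ a b
      exact Quotient.sound (NSTerm.Rel.smul_comp i h c a b))
    (fun a b b' => by
      induction a, b, b' using Quotient.inductionOn₃ with | _ a b b'
      exact Quotient.sound (NSTerm.Rel.comp_add i h a b b'))
    (fun c a b => by
      induction a, b using Quotient.inductionOn₂ with | _ a b
      exact Quotient.sound (NSTerm.Rel.comp_smul i h c a b))
  one_comp h a := by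
    induction a using Quotient.inductionOn with | _ a
    exact Quotient.sound (NSTerm.Rel.one_comp h a)
  comp_one i h a := by
    induction a using Quotient.inductionOn with | _ a
    exact Quotient.sound (NSTerm.Rel.comp_one i h a)
  comp_seq i j t hq hp hr hp' ht a b c := by
    induction a, b, c using Quotient.inductionOn₃ with | _ a b c
    exact Quotient.sound (NSTerm.Rel.comp_seq i j t hq hp hr hp' ht a b c)
  comp_par i k t i' hq hp hr hp' hik ht hi' a b c := by
    induction a, b, c using Quotient.inductionOn₃ with | _ a b c
    exact Quotient.sound (NSTerm.Rel.comp_par i k t i' hq hp hr hp' hik ht hi' a b c)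

/-- The inclusion of the generators in the free operad. -/
def NSFree.gen : E →ₗ[K] (NSFree K E).obj 2 where
  toFun e := Quotient.mk _ (NSTerm.gen e)
  map_add' e f := Quotient.sound (NSTerm.Rel.gen_add e f)
  map_smul' c e := Quotient.sound (NSTerm.Rel.gen_smul c e)

/-- The arity three component of the free nonsymmetric operad on the binary generators `E`, as the sum
of two copies of `E ⊗ E`, one for each planar binary tree with three leaves: `(e ⊗ f, 0)` stands for
`e ∘₁ f` and `(0, e ⊗ f)` stands for `e ∘₂ f`. -/
abbrev NSArityThree : Type v := (E ⊗[K] E) × (E ⊗[K] E)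

/-- The identification of `NSArityThree` with the arity three component of the free operad. -/
def NSArityThree.toFree : NSArityThree K E →ₗ[K] (NSFree K E).obj 3 :=
  LinearMap.coprod
    (TensorProduct.lift (((NSFree K E).comp (p := 3) (0 : Fin 2) rfl).compl₁₂
      (NSFree.gen K E) (NSFree.gen K E)))
    (TensorProduct.lift (((NSFree K E).comp (p := 3) (1 : Fin 2) rfl).compl₁₂
      (NSFree.gen K E) (NSFree.gen K E)))

/-- The pairing of the arity three components of the free operads on `E*` and `E`:
`⟨f ∘₁ g, a ∘₁ b⟩ = f(a)g(b)`, `⟨f ∘₂ g, a ∘₂ b⟩ = -f(a)g(b)`, and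
`⟨f ∘₁ g, a ∘₂ b⟩ = ⟨f ∘₂ g, a ∘₁ b⟩ = 0`. -/
noncomputable def NSArityThree.pairing :
    NSArityThree K (Module.Dual K E) →ₗ[K] Module.Dual K (NSArityThree K E) :=
  (LinearMap.fst K (E ⊗[K] E) (E ⊗[K] E)).dualMap ∘ₗ TensorProduct.dualDistrib K E E ∘ₗ
      LinearMap.fst K _ _
    - (LinearMap.snd K (E ⊗[K] E) (E ⊗[K] E)).dualMap ∘ₗ TensorProduct.dualDistrib K E E ∘ₗ
      LinearMap.snd K _ _

end NSFree

/-- Nonsymmetric binary quadratic data: a space `E` of binary generators, and a space of quadratic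
relations between them. -/
structure NSQuadraticData (K : Type u) [Field K] where
  E : Type v
  [addCommGroup : AddCommGroup E]
  [module : Module K E]
  rel : Submodule K (NSArityThree K E)

attribute [instance] NSQuadraticData.addCommGroup NSQuadraticData.module

namespace NSQuadraticData

variable {K : Type u} [Field K]

/-- The quadratic operad generated by `E` with relations `R`: the quotient of the free operad on `E`
by the operadic ideal generated by `R`. -/
def operad (D : NSQuadraticData.{u, v} K) : NSOperad.{u, max u v} K :=
  (NSFree K D.E).quot
    (NSOperad.Ideal.generate (NSFree K D.E) (k := 3) (NSArityThree.toFree K D.E '' D.rel))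

/-- The Koszul dual of quadratic data `(E, R)` (for `E` finite-dimensional): `(E*, R^⊥)`. -/
noncomputable def koszulDual (D : NSQuadraticData.{u, v} K) : NSQuadraticData.{u, max u v} K where
  E := Module.Dual K D.E
  rel := D.rel.dualAnnihilator.comap (NSArityThree.pairing K D.E)

end NSQuadraticData

/-! ## Symmetric operads -/

/-- The numbering of the inputs of `a ∘ᵢ b`, with `a` of arity `m` and `b` of arity `n`: they are the
inputs of `a` other than `i`, and the inputs of `b`, which take the place of the input `i`. -/
def compInputs {m n p : ℕ} (i : Fin m) (h : p + 1 = m + n) :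
    {k : Fin m // k ≠ i} ⊕ Fin n ≃ Fin p where
  toFun := Sum.elim
    (fun k => if hk : (k : Fin m).1 < i then ⟨(k : Fin m), by have := i.2; omega⟩
      else ⟨(k : Fin m) + n - 1, by
      have : (k : Fin m).1 ≠ i := fun e => k.2 (Fin.ext e)
      have := k.1.2
      omega⟩)
    (fun j => ⟨i + j, by have := i.2; omega⟩)
  invFun x :=
    if hx : (x : ℕ) < i then .inl ⟨⟨x, by omega⟩, by simp [Fin.ext_iff]; omega⟩
    else if hx' : (x : ℕ) < i + n then .inr ⟨x - i, by omega⟩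
    else .inl ⟨⟨x + 1 - n, by omega⟩, by simp [Fin.ext_iff]; omega⟩
  left_inv := by
    rintro (⟨k, hk⟩ | j)
    · have hk' : (k : ℕ) ≠ i := fun e => hk (Fin.ext e)
      by_cases h1 : (k : ℕ) < i
      · simp [h1, -Fin.val_fin_lt]
      · have h2 : ¬ ((k : ℕ) + n - 1 < i) := by omega
        have h3 : ¬ ((k : ℕ) + n - 1 < i + n) := by omega
        have h4 : (k : ℕ) + n - 1 + 1 - n = k := by omega
        simp [h1, h2, h3, h4, -Fin.val_fin_lt]
    · simp
  right_inv := by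
    intro x
    by_cases hx : (x : ℕ) < i
    · simp [hx, -Fin.val_fin_lt]
    · by_cases hx' : (x : ℕ) < i + n
      · have h4 : (i : ℕ) + (x - i) = x := by omega
        simp [hx, hx', h4]
      · have h1 : ¬ ((x : ℕ) + 1 - n < i) := by omega
        have h4 : (x : ℕ) + 1 - n + n - 1 = x := by omega
        simp [hx, hx', h1, h4, -Fin.val_fin_lt]

/-- The permutation of the inputs of `a ∘ᵢ b` induced by permutations `σ` of the inputs of `a` and `τ`
of the inputs of `b`. -/
def compPerm {m n p : ℕ} (i : Fin m) (h : p + 1 = m + n) (σ : Equiv.Perm (Fin m))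
    (τ : Equiv.Perm (Fin n)) : Equiv.Perm (Fin p) :=
  (compInputs i h).symm.trans
    ((Equiv.sumCongr (σ.subtypeEquiv (fun _ => by simp)) τ).trans (compInputs (σ i) h))

/-- A symmetric operad in `K`-vector spaces, in the partial definition. The symmetric group acts on the
left, `(σ • a)(x₁, …, xₙ) = a(x_{σ(1)}, …, x_{σ(n)})`; the usual right action is `a^σ = σ⁻¹ • a`. -/
structure SymOperad (K : Type u) [Field K] extends NSOperad.{u, w} K where
  /-- the action of the symmetric groups -/
  act : ∀ n, Representation K (Equiv.Perm (Fin n)) (obj n)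
  /-- equivariance of the partial compositions -/
  act_comp : ∀ {m n p : ℕ} (i : Fin m) (h : p + 1 = m + n) (σ : Equiv.Perm (Fin m))
    (τ : Equiv.Perm (Fin n)) (a : obj m) (b : obj n),
    comp (σ i) h (act m σ a) (act n τ b) = act p (compPerm i h σ τ) (comp i h a b)

namespace SymOperad

variable {K : Type u} [Field K]

/-- Isomorphisms of symmetric operads. -/
structure Iso (P : SymOperad.{u, w} K) (Q : SymOperad.{u, w'} K) extends
    NSOperad.Iso P.toNSOperad Q.toNSOperad where
  map_act : ∀ {n : ℕ} (σ : Equiv.Perm (Fin n)) (a : P.obj n),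
    toEquiv n (P.act n σ a) = Q.act n σ (toEquiv n a)

/-- Operadic ideals of a symmetric operad. -/
structure Ideal (P : SymOperad.{u, w} K) extends NSOperad.Ideal P.toNSOperad where
  act_mem : ∀ {n : ℕ} (σ : Equiv.Perm (Fin n)) {a : P.obj n},
    a ∈ carrier n → P.act n σ a ∈ carrier n

/-- The smallest operadic ideal containing a set `S` of operations of arity `k`. -/
def Ideal.generate (P : SymOperad.{u, w} K) {k : ℕ} (S : Set (P.obj k)) : P.Ideal where
  carrier n := ⨅ (I : P.Ideal) (_ : S ⊆ I.carrier k), I.carrier n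
  comp_mem_left := by
    intro m n p i h a b ha
    simp only [Submodule.mem_iInf] at ha ⊢
    exact fun I hI => I.comp_mem_left i h b (ha I hI)
  comp_mem_right := by
    intro m n p i h a b hb
    simp only [Submodule.mem_iInf] at hb ⊢
    exact fun I hI => I.comp_mem_right i h a (hb I hI)
  act_mem := by
    intro n σ a ha
    simp only [Submodule.mem_iInf] at ha ⊢
    exact fun I hI => I.act_mem σ (ha I hI)

/-- The quotient of a symmetric operad by an operadic ideal. -/
def quot (P : SymOperad.{u, w} K) (I : P.Ideal) : SymOperad.{u, w} K where
  toNSOperad := P.toNSOperad.quot I.toIdeal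
  act n :=
    { toFun := fun σ => (I.carrier n).mapQ (I.carrier n) (P.act n σ) (fun _ ha => I.act_mem σ ha)
      map_one' := by
        refine LinearMap.ext fun a => ?_
        induction a using Submodule.Quotient.induction_on with | _ a
        exact congrArg Submodule.Quotient.mk (by simp)
      map_mul' := fun σ τ => by
        refine LinearMap.ext fun a => ?_
        induction a using Submodule.Quotient.induction_on with | _ a
        exact congrArg Submodule.Quotient.mk (by simp) }
  act_comp i h σ τ a b := by
    induction a using Submodule.Quotient.induction_on with | _ a
    induction b using Submodule.Quotient.induction_on with | _ b
    exact congrArg Submodule.Quotient.mk (P.act_comp i h σ τ a b)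

end SymOperad

/-! ### The free symmetric operad on a representation of the symmetric group on two letters -/

/-- Formal symmetric operadic expressions in binary generators from `E`. -/
inductive SymTerm (K : Type u) (E : Type v) : ℕ → Type (max u v)
  | zero (n : ℕ) : SymTerm K E n
  | add {n : ℕ} (x y : SymTerm K E n) : SymTerm K E n
  | smul {n : ℕ} (c : K) (x : SymTerm K E n) : SymTerm K E n
  | act {n : ℕ} (σ : Equiv.Perm (Fin n)) (x : SymTerm K E n) : SymTerm K E n
  | one : SymTerm K E 1
  | gen (e : E) : SymTerm K E 2
  | comp {m n p : ℕ} (i : Fin m) (h : p + 1 = m + n) (x : SymTerm K E m) (y : SymTerm K E n) :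
      SymTerm K E p

/-- The smallest congruence on formal expressions that makes them a symmetric operad in vector spaces,
in which the generators depend linearly on `e : E` and the transposition acts on them through `s`. -/
inductive SymTerm.Rel (K : Type u) [Field K] {E : Type v} [AddCommGroup E] [Module K E]
    (s : E →ₗ[K] E) : ∀ {n : ℕ}, SymTerm K E n → SymTerm K E n → Prop
  -- equivalence relation, compatible with the operations
  | refl {n : ℕ} (x : SymTerm K E n) : Rel K s x x
  | symm {n : ℕ} {x y : SymTerm K E n} : Rel K s x y → Rel K s y x
  | trans {n : ℕ} {x y z : SymTerm K E n} : Rel K s x y → Rel K s y z → Rel K s x z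
  | add_congr {n : ℕ} {x x' y y' : SymTerm K E n} :
      Rel K s x x' → Rel K s y y' → Rel K s (.add x y) (.add x' y')
  | smul_congr {n : ℕ} (c : K) {x x' : SymTerm K E n} :
      Rel K s x x' → Rel K s (.smul c x) (.smul c x')
  | act_congr {n : ℕ} (σ : Equiv.Perm (Fin n)) {x x' : SymTerm K E n} :
      Rel K s x x' → Rel K s (.act σ x) (.act σ x')
  | comp_congr {m n p : ℕ} (i : Fin m) (h : p + 1 = m + n) {x x' : SymTerm K E m}
      {y y' : SymTerm K E n} :
      Rel K s x x' → Rel K s y y' → Rel K s (.comp i h x y) (.comp i h x' y')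
  -- vector space axioms
  | add_assoc {n : ℕ} (x y z : SymTerm K E n) :
      Rel K s (.add (.add x y) z) (.add x (.add y z))
  | add_comm {n : ℕ} (x y : SymTerm K E n) : Rel K s (.add x y) (.add y x)
  | zero_add {n : ℕ} (x : SymTerm K E n) : Rel K s (.add (.zero n) x) x
  | smul_add {n : ℕ} (c : K) (x y : SymTerm K E n) :
      Rel K s (.smul c (.add x y)) (.add (.smul c x) (.smul c y))
  | add_smul {n : ℕ} (c d : K) (x : SymTerm K E n) :
      Rel K s (.smul (c + d) x) (.add (.smul c x) (.smul d x))
  | mul_smul {n : ℕ} (c d : K) (x : SymTerm K E n) :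
      Rel K s (.smul (c * d) x) (.smul c (.smul d x))
  | one_smul {n : ℕ} (x : SymTerm K E n) : Rel K s (.smul 1 x) x
  | zero_smul {n : ℕ} (x : SymTerm K E n) : Rel K s (.smul 0 x) (.zero n)
  -- the generators: linearity and equivariance
  | gen_add (e f : E) : Rel K s (.gen (e + f)) (.add (.gen e) (.gen f))
  | gen_smul (c : K) (e : E) : Rel K s (.gen (c • e)) (.smul c (.gen e))
  | act_gen (e : E) : Rel K s (.act (Equiv.swap 0 1) (.gen e)) (.gen (s e))
  -- the symmetric groups act linearly
  | act_add {n : ℕ} (σ : Equiv.Perm (Fin n)) (x y : SymTerm K E n) :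
      Rel K s (.act σ (.add x y)) (.add (.act σ x) (.act σ y))
  | act_smul {n : ℕ} (σ : Equiv.Perm (Fin n)) (c : K) (x : SymTerm K E n) :
      Rel K s (.act σ (.smul c x)) (.smul c (.act σ x))
  | one_act {n : ℕ} (x : SymTerm K E n) : Rel K s (.act 1 x) x
  | mul_act {n : ℕ} (σ τ : Equiv.Perm (Fin n)) (x : SymTerm K E n) :
      Rel K s (.act (σ * τ) x) (.act σ (.act τ x))
  -- bilinearity of the partial compositions
  | add_comp {m n p : ℕ} (i : Fin m) (h : p + 1 = m + n) (x x' : SymTerm K E m)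
      (y : SymTerm K E n) :
      Rel K s (.comp i h (.add x x') y) (.add (.comp i h x y) (.comp i h x' y))
  | smul_comp {m n p : ℕ} (i : Fin m) (h : p + 1 = m + n) (c : K) (x : SymTerm K E m)
      (y : SymTerm K E n) :
      Rel K s (.comp i h (.smul c x) y) (.smul c (.comp i h x y))
  | comp_add {m n p : ℕ} (i : Fin m) (h : p + 1 = m + n) (x : SymTerm K E m)
      (y y' : SymTerm K E n) :
      Rel K s (.comp i h x (.add y y')) (.add (.comp i h x y) (.comp i h x y'))
  | comp_smul {m n p : ℕ} (i : Fin m) (h : p + 1 = m + n) (c : K) (x : SymTerm K E m)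
      (y : SymTerm K E n) :
      Rel K s (.comp i h x (.smul c y)) (.smul c (.comp i h x y))
  -- operad axioms
  | one_comp {n : ℕ} (h : n + 1 = 1 + n) (x : SymTerm K E n) : Rel K s (.comp 0 h .one x) x
  | comp_one {m : ℕ} (i : Fin m) (h : m + 1 = m + 1) (x : SymTerm K E m) :
      Rel K s (.comp i h x .one) x
  | comp_seq {l m n q r p : ℕ} (i : Fin l) (j : Fin m) (t : Fin q)
      (hq : q + 1 = l + m) (hp : p + 1 = q + n) (hr : r + 1 = m + n) (hp' : p + 1 = l + r)
      (ht : (t : ℕ) = i + j) (x : SymTerm K E l) (y : SymTerm K E m) (z : SymTerm K E n) :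
      Rel K s (.comp t hp (.comp i hq x y) z) (.comp i hp' x (.comp j hr y z))
  | comp_par {l m n q r p : ℕ} (i k : Fin l) (t : Fin q) (i' : Fin r)
      (hq : q + 1 = l + m) (hp : p + 1 = q + n) (hr : r + 1 = l + n) (hp' : p + 1 = r + m)
      (hik : i < k) (ht : (t : ℕ) + 1 = k + m) (hi' : (i' : ℕ) = i)
      (x : SymTerm K E l) (y : SymTerm K E m) (z : SymTerm K E n) :
      Rel K s (.comp t hp (.comp i hq x y) z) (.comp i' hp' (.comp k hr x z) y)
  | act_comp {m n p : ℕ} (i : Fin m) (h : p + 1 = m + n) (σ : Equiv.Perm (Fin m))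
      (τ : Equiv.Perm (Fin n)) (x : SymTerm K E m) (y : SymTerm K E n) :
      Rel K s (.comp (σ i) h (.act σ x) (.act τ y)) (.act (compPerm i h σ τ) (.comp i h x y))

section SymFree

variable (K : Type u) [Field K] {E : Type v} [AddCommGroup E] [Module K E] (s : E →ₗ[K] E)

/-- The congruence on formal expressions, as a setoid. -/
def SymTerm.setoid (n : ℕ) : Setoid (SymTerm K E n) :=
  ⟨SymTerm.Rel K s, SymTerm.Rel.refl, SymTerm.Rel.symm, SymTerm.Rel.trans⟩

/-- The arity `n` component of the free symmetric operad generated by `(E, s)` in arity two. -/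
def SymFreeObj (n : ℕ) : Type (max u v) := Quotient (SymTerm.setoid K s n)

instance SymFreeObj.instZero (n : ℕ) : Zero (SymFreeObj K s n) :=
  ⟨Quotient.mk _ (SymTerm.zero n)⟩

instance SymFreeObj.instAdd (n : ℕ) : Add (SymFreeObj K s n) :=
  ⟨Quotient.map₂ SymTerm.add (fun _ _ h _ _ h' => SymTerm.Rel.add_congr h h')⟩

instance SymFreeObj.instNeg (n : ℕ) : Neg (SymFreeObj K s n) :=
  ⟨Quotient.map (SymTerm.smul (-1)) (fun _ _ h => SymTerm.Rel.smul_congr _ h)⟩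

instance SymFreeObj.instAddCommGroup (n : ℕ) : AddCommGroup (SymFreeObj K s n) where
  add_assoc a b c := by
    induction a, b, c using Quotient.inductionOn₃ with | _ a b c
    exact Quotient.sound (SymTerm.Rel.add_assoc a b c)
  add_comm a b := by
    induction a, b using Quotient.inductionOn₂ with | _ a b
    exact Quotient.sound (SymTerm.Rel.add_comm a b)
  zero_add a := by
    induction a using Quotient.inductionOn with | _ a
    exact Quotient.sound (SymTerm.Rel.zero_add a)
  add_zero a := by
    induction a using Quotient.inductionOn with | _ a
    exact Quotient.sound ((SymTerm.Rel.add_comm _ _).trans (SymTerm.Rel.zero_add a))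
  nsmul := nsmulRec
  zsmul := zsmulRec
  neg_add_cancel a := by
    induction a using Quotient.inductionOn with | _ a
    refine Quotient.sound (?_ : SymTerm.Rel K s (.add (.smul (-1) a) a) (.zero n))
    refine ((SymTerm.Rel.refl _).add_congr (SymTerm.Rel.one_smul a).symm).trans ?_
    refine (SymTerm.Rel.add_smul (-1) 1 a).symm.trans ?_
    rw [neg_add_cancel]
    exact SymTerm.Rel.zero_smul a

instance SymFreeObj.instModule (n : ℕ) : Module K (SymFreeObj K s n) where
  smul c := Quotient.map (SymTerm.smul c) (fun _ _ h => SymTerm.Rel.smul_congr _ h)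
  one_smul a := by
    induction a using Quotient.inductionOn with | _ a
    exact Quotient.sound (SymTerm.Rel.one_smul a)
  mul_smul c d a := by
    induction a using Quotient.inductionOn with | _ a
    exact Quotient.sound (SymTerm.Rel.mul_smul c d a)
  smul_add c a b := by
    induction a, b using Quotient.inductionOn₂ with | _ a b
    exact Quotient.sound (SymTerm.Rel.smul_add c a b)
  add_smul c d a := by
    induction a using Quotient.inductionOn with | _ a
    exact Quotient.sound (SymTerm.Rel.add_smul c d a)
  zero_smul a := by
    induction a using Quotient.inductionOn with | _ a
    exact Quotient.sound (SymTerm.Rel.zero_smul a)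
  smul_zero c := by
    refine Quotient.sound (?_ : SymTerm.Rel K s (.smul c (.zero n)) (.zero n))
    refine (SymTerm.Rel.smul_congr c (SymTerm.Rel.zero_smul (.zero n)).symm).trans ?_
    refine (SymTerm.Rel.mul_smul c 0 _).symm.trans ?_
    rw [mul_zero]
    exact SymTerm.Rel.zero_smul _

/-- The free symmetric operad generated by the vector space `E`, placed in arity two, on which the
transposition acts by the involution `s`. -/
def SymFree : SymOperad.{u, max u v} K where
  obj := SymFreeObj K s
  one := Quotient.mk _ SymTerm.one
  comp i h := LinearMap.mk₂ K
    (Quotient.map₂ (SymTerm.comp i h) (fun _ _ hx _ _ hy => SymTerm.Rel.comp_congr i h hx hy))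
    (fun a a' b => by
      induction a, a', b using Quotient.inductionOn₃ with | _ a a' b
      exact Quotient.sound (SymTerm.Rel.add_comp i h a a' b))
    (fun c a b => by
      induction a, b using Quotient.inductionOn₂ with | _ a b
      exact Quotient.sound (SymTerm.Rel.smul_comp i h c a b))
    (fun a b b' => by
      induction a, b, b' using Quotient.inductionOn₃ with | _ a b b'
      exact Quotient.sound (SymTerm.Rel.comp_add i h a b b'))
    (fun c a b => by
      induction a, b using Quotient.inductionOn₂ with | _ a b
      exact Quotient.sound (SymTerm.Rel.comp_smul i h c a b))
  one_comp h a := by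
    induction a using Quotient.inductionOn with | _ a
    exact Quotient.sound (SymTerm.Rel.one_comp h a)
  comp_one i h a := by
    induction a using Quotient.inductionOn with | _ a
    exact Quotient.sound (SymTerm.Rel.comp_one i h a)
  comp_seq i j t hq hp hr hp' ht a b c := by
    induction a, b, c using Quotient.inductionOn₃ with | _ a b c
    exact Quotient.sound (SymTerm.Rel.comp_seq i j t hq hp hr hp' ht a b c)
  comp_par i k t i' hq hp hr hp' hik ht hi' a b c := by
    induction a, b, c using Quotient.inductionOn₃ with | _ a b c
    exact Quotient.sound (SymTerm.Rel.comp_par i k t i' hq hp hr hp' hik ht hi' a b c)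
  act n :=
    { toFun := fun σ =>
        { toFun := Quotient.map (SymTerm.act σ) (fun _ _ h => SymTerm.Rel.act_congr σ h)
          map_add' := fun a b => by
            induction a, b using Quotient.inductionOn₂ with | _ a b
            exact Quotient.sound (SymTerm.Rel.act_add σ a b)
          map_smul' := fun c a => by
            induction a using Quotient.inductionOn with | _ a
            exact Quotient.sound (SymTerm.Rel.act_smul σ c a) }
      map_one' := by
        refine LinearMap.ext fun a => ?_
        induction a using Quotient.inductionOn with | _ a
        exact Quotient.sound (SymTerm.Rel.one_act a)
      map_mul' := fun σ τ => by
        refine LinearMap.ext fun a => ?_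
        induction a using Quotient.inductionOn with | _ a
        exact Quotient.sound (SymTerm.Rel.mul_act σ τ a) }
  act_comp i h σ τ a b := by
    induction a, b using Quotient.inductionOn₂ with | _ a b
    exact Quotient.sound (SymTerm.Rel.act_comp i h σ τ a b)

/-- The inclusion of the generators in the free operad. -/
def SymFree.gen : E →ₗ[K] (SymFree K s).obj 2 where
  toFun e := Quotient.mk _ (SymTerm.gen e)
  map_add' e f := Quotient.sound (SymTerm.Rel.gen_add e f)
  map_smul' c e := Quotient.sound (SymTerm.Rel.gen_smul c e)

variable (E) in
/-- The arity three component of the free symmetric operad on the binary generators `E`, as the sum of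
three copies of `E ⊗ E`: in the copy with index `k`, the tensor `e ⊗ f` stands for the operation
`e(f(x_{k+1}, x_{k+2}), x_k)`, with indices modulo three. -/
abbrev SymArityThree : Type v := Fin 3 → E ⊗[K] E

namespace SymArityThree

/-- The identification of `SymArityThree` with the arity three component of the free operad. -/
def toFree : SymArityThree K E →ₗ[K] (SymFree K s).obj 3 :=
  ∑ k : Fin 3, (SymFree K s).act 3 (Equiv.addRight (k + 1)) ∘ₗ
    TensorProduct.lift (((SymFree K s).comp (p := 3) (0 : Fin 2) rfl).compl₁₂
      (SymFree.gen K s) (SymFree.gen K s)) ∘ₗ LinearMap.proj k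

variable {K}

/-- The operation `e ∘₁ f`, that is `e(f(x₀, x₁), x₂)`, for `e ⊗ f` in `E ⊗ E`. -/
def comp₁ : E ⊗[K] E →ₗ[K] SymArityThree K E :=
  LinearMap.single K (fun _ : Fin 3 => E ⊗[K] E) 2

/-- The operation `e ∘₂ f`, that is `e(x₀, f(x₁, x₂)) = (s e)(f(x₁, x₂), x₀)`, for `e ⊗ f` in
`E ⊗ E`. -/
noncomputable def comp₂ : E ⊗[K] E →ₗ[K] SymArityThree K E :=
  LinearMap.single K (fun _ : Fin 3 => E ⊗[K] E) 0 ∘ₗ s.rTensor E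

/-- The action of a permutation on the arity three component: the summand with index `k` is sent to
the one with index `σ k`, and an odd permutation reverses the cyclic order of the inputs, hence
exchanges the two inputs of the inner operation. -/
noncomputable def act (σ : Equiv.Perm (Fin 3)) : SymArityThree K E →ₗ[K] SymArityThree K E :=
  LinearMap.pi fun k =>
    (if Equiv.Perm.sign σ = 1 then LinearMap.id else s.lTensor E) ∘ₗ LinearMap.proj (σ⁻¹ k)

variable {s} in
theorem act_mul (hs : s ∘ₗ s = LinearMap.id) (σ τ : Equiv.Perm (Fin 3)) :
    act s (σ * τ) = act s σ ∘ₗ act s τ := by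
  have hs' : s.lTensor E ∘ₗ s.lTensor E = LinearMap.id := by
    rw [← LinearMap.lTensor_comp, hs, LinearMap.lTensor_id]
  refine LinearMap.ext fun x => funext fun k => ?_
  rcases Int.units_eq_one_or (Equiv.Perm.sign σ) with h1 | h1 <;>
  rcases Int.units_eq_one_or (Equiv.Perm.sign τ) with h2 | h2
  · simp [act, h1, h2]
  · simp [act, h1, h2]
  · simp [act, h1, h2]
  · simpa [act, h1, h2] using (LinearMap.congr_fun hs' _).symm

variable (K E) in
/-- The pairing of the arity three components of the free operads on `E* ⊗ sgn` and `E`: the sum over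
the three copies of the canonical pairings of `E* ⊗ E*` with `E ⊗ E`. -/
noncomputable def pairing :
    SymArityThree K (Module.Dual K E) →ₗ[K] Module.Dual K (SymArityThree K E) :=
  ∑ k : Fin 3, (LinearMap.proj (R := K) (φ := fun _ : Fin 3 => E ⊗[K] E) k).dualMap ∘ₗ
    TensorProduct.dualDistrib K E E ∘ₗ LinearMap.proj k

theorem pairing_act (σ : Equiv.Perm (Fin 3)) (f : SymArityThree K (Module.Dual K E))
    (x : SymArityThree K E) :
    pairing K E (act (-s.dualMap) σ f) x =
      ((Equiv.Perm.sign σ : ℤ) : K) * pairing K E f (act s σ⁻¹ x) := by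
  have key : ∀ (g : Module.Dual K E ⊗[K] Module.Dual K E) (y : E ⊗[K] E),
      TensorProduct.dualDistrib K E E ((-s.dualMap).lTensor _ g) y =
        -TensorProduct.dualDistrib K E E g (s.lTensor E y) := by
    intro g y
    induction g with
    | zero => simp
    | add g g' h h' => simp only [map_add, LinearMap.add_apply, h, h', neg_add]
    | tmul f f' =>
      induction y with
      | zero => simp
      | add y y' h h' => simp only [map_add, h, h', neg_add]
      | tmul a b =>
        rw [LinearMap.lTensor_tmul, LinearMap.lTensor_tmul, TensorProduct.dualDistrib_apply,
          TensorProduct.dualDistrib_apply]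
        exact mul_neg (f a) (f' (s b))
  simp only [pairing, LinearMap.sum_apply, LinearMap.comp_apply, LinearMap.dualMap_apply,
    LinearMap.proj_apply]
  rw [← Equiv.sum_comp σ, Finset.mul_sum]
  refine Finset.sum_congr rfl fun k _ => ?_
  rcases Int.units_eq_one_or (Equiv.Perm.sign σ) with h1 | h1
  · simp [act, h1]
  · have hne : ¬ ((-1 : ℤˣ) = 1) := by decide
    have h2 : Equiv.Perm.sign σ⁻¹ = -1 := by rw [Equiv.Perm.sign_inv, h1]
    have e1 : act (-s.dualMap) σ f (σ k) = (-s.dualMap).lTensor (Module.Dual K E) (f k) := by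
      simp only [act, h1, hne, if_false, LinearMap.pi_apply, LinearMap.comp_apply,
        LinearMap.proj_apply]
      simp
    have e2 : act s σ⁻¹ x k = s.lTensor E (x (σ k)) := by
      simp only [act, h2, hne, if_false, LinearMap.pi_apply, LinearMap.comp_apply,
        LinearMap.proj_apply]
      simp
    rw [e1, e2, key, h1]
    simp

end SymArityThree

end SymFree

/-- Symmetric binary quadratic data: a space `E` of binary generators, with the action `s` of the
transposition on it, and a space of quadratic relations stable under the symmetric group. -/
structure SymQuadraticData (K : Type u) [Field K] where
  E : Type v
  [addCommGroup : AddCommGroup E]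
  [module : Module K E]
  s : E →ₗ[K] E
  s_comp_s : s ∘ₗ s = LinearMap.id
  rel : Submodule K (SymArityThree K E)
  act_mem_rel : ∀ (σ : Equiv.Perm (Fin 3)) (x : SymArityThree K E),
    x ∈ rel → SymArityThree.act s σ x ∈ rel

attribute [instance] SymQuadraticData.addCommGroup SymQuadraticData.module

namespace SymQuadraticData

variable {K : Type u} [Field K]

/-- The quadratic operad generated by `(E, s)` with relations `R`: the quotient of the free symmetric
operad on `(E, s)` by the operadic ideal generated by `R`. -/
def operad (D : SymQuadraticData.{u, v} K) : SymOperad.{u, max u v} K :=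
  (SymFree K D.s).quot
    (SymOperad.Ideal.generate (SymFree K D.s) (k := 3) (SymArityThree.toFree K D.s '' D.rel))

/-- The Koszul dual of quadratic data `(E, R)` (for `E` finite-dimensional): `(E* ⊗ sgn, R^⊥)`. -/
noncomputable def koszulDual (D : SymQuadraticData.{u, v} K) :
    SymQuadraticData.{u, max u v} K where
  E := Module.Dual K D.E
  s := -D.s.dualMap
  s_comp_s := by
    refine LinearMap.ext fun f => LinearMap.ext fun e => ?_
    simpa using congrArg f (LinearMap.congr_fun D.s_comp_s e)
  rel := D.rel.dualAnnihilator.comap (SymArityThree.pairing K D.E)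
  act_mem_rel σ f hf := by
    rw [Submodule.mem_comap, Submodule.mem_dualAnnihilator] at hf ⊢
    intro x hx
    rw [SymArityThree.pairing_act, hf _ (D.act_mem_rel σ⁻¹ x hx), mul_zero]

end SymQuadraticData

/-! ## The operads of `Φ`-associative algebras -/

section PhiAssociative

variable {K : Type u} [Field K] {A : Type v} [AddCommGroup A] [Module K A]

/-- `(A, Φ)` is a linear extended associative semigroup:
`(Id ⊗ Φ) ∘ (Φ ⊗ Id) ∘ (Id ⊗ Φ) = (Φ ⊗ Id) ∘ (Id ⊗ τ) ∘ (Φ ⊗ Id)`, where `τ` is the flip. -/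
def IsLinearEAS (Φ : A ⊗[K] A →ₗ[K] A ⊗[K] A) : Prop :=
  let idΦ : A ⊗[K] (A ⊗[K] A) →ₗ[K] A ⊗[K] (A ⊗[K] A) := Φ.lTensor A
  let Φid : A ⊗[K] (A ⊗[K] A) →ₗ[K] A ⊗[K] (A ⊗[K] A) :=
    (TensorProduct.assoc K A A A).toLinearMap ∘ₗ Φ.rTensor A ∘ₗ
      (TensorProduct.assoc K A A A).symm.toLinearMap
  let idτ : A ⊗[K] (A ⊗[K] A) →ₗ[K] A ⊗[K] (A ⊗[K] A) :=
    (TensorProduct.comm K A A).toLinearMap.lTensor A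
  idΦ ∘ₗ Φid ∘ₗ idΦ = Φid ∘ₗ idτ ∘ₗ Φid

/-- The transpose `Φ* : A* ⊗ A* → A* ⊗ A*` of `Φ`, where `A* ⊗ A*` is identified with `(A ⊗ A)*`. -/
noncomputable def transposeTensor [FiniteDimensional K A] (Φ : A ⊗[K] A →ₗ[K] A ⊗[K] A) :
    Module.Dual K A ⊗[K] Module.Dual K A →ₗ[K] Module.Dual K A ⊗[K] Module.Dual K A :=
  (TensorProduct.dualDistribEquiv K A A).symm.toLinearMap ∘ₗ Φ.dualMap ∘ₗ
    (TensorProduct.dualDistribEquiv K A A).toLinearMap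

/-- The quadratic data of the nonsymmetric operad `As_Φ`: generators `A`, and relations
`a ∘₂ b = ∑ (a' → b') ∘₁ (a'' ▷ b'')`, where `Φ (a ⊗ b) = ∑ (a' → b') ⊗ (a'' ▷ b'')`. -/
noncomputable def asData (Φ : A ⊗[K] A →ₗ[K] A ⊗[K] A) : NSQuadraticData.{u, v} K where
  E := A
  rel := Submodule.span K
    {x | ∃ a b : A, x = LinearMap.inr K (A ⊗[K] A) (A ⊗[K] A) (a ⊗ₜ[K] b)
      - LinearMap.inl K (A ⊗[K] A) (A ⊗[K] A) (Φ (a ⊗ₜ[K] b))}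

/-- The quadratic data of the nonsymmetric operad `As'_Φ`: generators `A`, and relations
`a ∘₁ b = ∑ (a' → b') ∘₂ (a'' ▷ b'')`, where `Φ (a ⊗ b) = ∑ (a' → b') ⊗ (a'' ▷ b'')`. -/
noncomputable def asOppData (Φ : A ⊗[K] A →ₗ[K] A ⊗[K] A) : NSQuadraticData.{u, v} K where
  E := A
  rel := Submodule.span K
    {x | ∃ a b : A, x = LinearMap.inl K (A ⊗[K] A) (A ⊗[K] A) (a ⊗ₜ[K] b)
      - LinearMap.inr K (A ⊗[K] A) (A ⊗[K] A) (Φ (a ⊗ₜ[K] b))}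

/-- The quadratic data of the symmetric operad `Sym As_Φ` of `Φ`-associative algebras. The generators
are `A ⊗ K[S₂] = A × A`: `(a, 0)` stands for the product `x *_a y`, and `(0, a)` for the opposite
product `y *_a x`. The relations are spanned by the images under permutations of the variables of
`x *_a (y *_b z) = ∑ (x *_{a'' ▷ b''} y) *_{a' → b'} z`. -/
noncomputable def symAsData (Φ : A ⊗[K] A →ₗ[K] A ⊗[K] A) : SymQuadraticData.{u, v} K where
  E := A × A
  s := (LinearEquiv.prodComm K A A).toLinearMap
  s_comp_s := rfl
  rel := Submodule.span K
    {x | ∃ (σ : Equiv.Perm (Fin 3)) (a b : A),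
      x = SymArityThree.act (LinearEquiv.prodComm K A A).toLinearMap σ
        (SymArityThree.comp₂ (LinearEquiv.prodComm K A A).toLinearMap
            (TensorProduct.map (LinearMap.inl K A A) (LinearMap.inl K A A) (a ⊗ₜ[K] b))
          - SymArityThree.comp₁
            (TensorProduct.map (LinearMap.inl K A A) (LinearMap.inl K A A) (Φ (a ⊗ₜ[K] b))))}
  act_mem_rel σ x hx := by
    refine Submodule.span_induction (p := fun x _ => SymArityThree.act _ σ x ∈ _)
      ?_ ?_ ?_ ?_ hx
    · rintro _ ⟨τ, a, b, rfl⟩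
      refine Submodule.subset_span ⟨σ * τ, a, b, ?_⟩
      rw [SymArityThree.act_mul (by rfl)]
      rfl
    · rw [map_zero]
      exact Submodule.zero_mem _
    · intro y z _ _ hy hz
      rw [map_add]
      exact Submodule.add_mem _ hy hz
    · intro c y _ hy
      rw [map_smul]
      exact Submodule.smul_mem _ c hy

/-- The nonsymmetric operad `As_Φ` of `Φ`-associative algebras. -/
noncomputable abbrev As (Φ : A ⊗[K] A →ₗ[K] A ⊗[K] A) : NSOperad.{u, max u v} K :=
  (asData Φ).operad

/-- The nonsymmetric operad `As'_Φ` of opposite `Φ`-associative algebras. -/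
noncomputable abbrev AsOpp (Φ : A ⊗[K] A →ₗ[K] A ⊗[K] A) : NSOperad.{u, max u v} K :=
  (asOppData Φ).operad

/-- The symmetric operad `Sym As_Φ` of `Φ`-associative algebras. -/
noncomputable abbrev SymAs (Φ : A ⊗[K] A →ₗ[K] A ⊗[K] A) : SymOperad.{u, max u v} K :=
  (symAsData Φ).operad

end PhiAssociative

/-! The relations of each operad form the graph of a linear map built from `-Φ`, and the orthogonal
of a graph is the graph of a transpose read in the opposite direction.

Nonsymmetric case. The relations of `As_Φ` are the pairs `(-Φ y, y)`. Because of the sign in the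
pairing, `(F₁, F₂)` is orthogonal to all of them iff `F₂ = -Φ* F₁`, which is the space of relations
of `As'_{Φ*}`; the other case is the mirror image. Thus the quadratic data themselves are equal
(`asData_koszulDual`, `asOppData_koszulDual`), and the identity is the isomorphism.

Symmetric case. With generators `A × A`, the arity three component is a sum of twelve copies of `A ⊗
A`: three trees, and for each of them the blocks inl-inl, inl-inr, inr-inl, inr-inr, named by the
outer and then the inner generator. The six permuted relations leave the blocks with outer factor
inr free and express those with outer factor inl through them by `-Φ` (`symAsRel_eq`). In the
orthogonal the roles are exchanged: the outer-inl blocks are free and `Φ*` determines the others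
(`mem_symAsRel_orthogonal`). Exchanging the two factors of the dual generators, that is, passing to
opposite products, restores the shape of `Sym As_{Φ*}`. A sign on one factor accounts both for the
sign representation and for the missing minus signs (`dualProdTwist`, `map_prod_neg_mem_symAsRel`).
This isomorphism of generators extends to the quotient operads by `SymQuadraticData.operadCongr`. -/

/-! ### Isomorphisms, ideals and quotients of operads -/

namespace NSOperad

variable {K : Type u} [Field K]

/-- The identity isomorphism of a nonsymmetric operad. -/
def Iso.refl (P : NSOperad.{u, w} K) : Iso P P where
  toEquiv _ := LinearEquiv.refl K _
  map_one := rfl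
  map_comp _ _ _ _ := rfl

end NSOperad

namespace SymOperad

variable {K : Type u} [Field K] {P : SymOperad.{u, w} K} {Q : SymOperad.{u, w'} K}

/-- The inverse of an isomorphism of symmetric operads. -/
def Iso.symm (e : Iso P Q) : Iso Q P where
  toEquiv n := (e.toEquiv n).symm
  map_one := by rw [LinearEquiv.symm_apply_eq, e.map_one]
  map_comp i h a b := by rw [LinearEquiv.symm_apply_eq, e.map_comp]; simp
  map_act σ a := by rw [LinearEquiv.symm_apply_eq, e.map_act]; simp

/-- The inverse image of an operadic ideal under an isomorphism. -/
def Ideal.comap (e : Iso P Q) (J : Q.Ideal) : P.Ideal where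
  carrier n := (J.carrier n).comap (e.toEquiv n).toLinearMap
  comp_mem_left i h a b ha := by
    simp only [Submodule.mem_comap, LinearEquiv.coe_coe, e.map_comp] at ha ⊢
    exact J.comp_mem_left i h _ ha
  comp_mem_right i h a b hb := by
    simp only [Submodule.mem_comap, LinearEquiv.coe_coe, e.map_comp] at hb ⊢
    exact J.comp_mem_right i h _ hb
  act_mem σ a ha := by
    simp only [Submodule.mem_comap, LinearEquiv.coe_coe, e.map_act] at ha ⊢
    exact J.act_mem σ ha

theorem Ideal.mem_generate {k : ℕ} {S : Set (P.obj k)} {n : ℕ} {x : P.obj n} :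
    x ∈ (Ideal.generate P S).carrier n ↔
      ∀ I : P.Ideal, S ⊆ I.carrier k → x ∈ I.carrier n := by
  simp [Ideal.generate, Submodule.mem_iInf]

/-- An ideal of `Q` containing `T` pulls back to an ideal of `P` containing `S`, hence to one of the
ideals whose intersection is the ideal generated by `S`. -/
theorem Ideal.map_mem_generate (e : Iso P Q) {k : ℕ} {S : Set (P.obj k)} {T : Set (Q.obj k)}
    (h : ∀ x ∈ S, e.toEquiv k x ∈ T) {n : ℕ} {x : P.obj n}
    (hx : x ∈ (Ideal.generate P S).carrier n) :
    e.toEquiv n x ∈ (Ideal.generate Q T).carrier n := by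
  rw [Ideal.mem_generate] at hx ⊢
  exact fun J hJ => hx (J.comap e) fun y hy => hJ (h y hy)

/-- An isomorphism of operads that identifies two operadic ideals induces an isomorphism of the
quotients. -/
def Iso.quot (e : Iso P Q) (I : P.Ideal) (J : Q.Ideal)
    (h : ∀ n, ∀ x ∈ I.carrier n, e.toEquiv n x ∈ J.carrier n)
    (h' : ∀ n, ∀ y ∈ J.carrier n, (e.toEquiv n).symm y ∈ I.carrier n) :
    Iso (P.quot I) (Q.quot J) where
  toEquiv n := LinearEquiv.ofLinearMap
    ((I.carrier n).mapQ (J.carrier n) (e.toEquiv n).toLinearMap (h n))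
    ((J.carrier n).mapQ (I.carrier n) (e.toEquiv n).symm.toLinearMap (h' n))
    (by
      refine LinearMap.ext fun a => ?_
      induction a using Submodule.Quotient.induction_on with | _ a
      exact congrArg Submodule.Quotient.mk ((e.toEquiv n).apply_symm_apply a))
    (by
      refine LinearMap.ext fun a => ?_
      induction a using Submodule.Quotient.induction_on with | _ a
      exact congrArg Submodule.Quotient.mk ((e.toEquiv n).symm_apply_apply a))
  map_one := congrArg Submodule.Quotient.mk e.map_one
  map_comp i h a b := by
    induction a using Submodule.Quotient.induction_on with | _ a
    induction b using Submodule.Quotient.induction_on with | _ b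
    exact congrArg Submodule.Quotient.mk (e.map_comp i h a b)
  map_act σ a := by
    induction a using Submodule.Quotient.induction_on with | _ a
    exact congrArg Submodule.Quotient.mk (e.map_act σ a)

end SymOperad

/-! ### Functoriality of free and quadratic symmetric operads in the generators -/

/-- The substitution of generators in formal expressions. -/
def SymTerm.map {K : Type u} {E : Type v} {F : Type w} (θ : E → F) :
    ∀ {n : ℕ}, SymTerm K E n → SymTerm K F n
  | _, .zero n => .zero n
  | _, .add x y => .add (x.map θ) (y.map θ)
  | _, .smul c x => .smul c (x.map θ)
  | _, .act σ x => .act σ (x.map θ)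
  | _, .one => .one
  | _, .gen e => .gen (θ e)
  | _, .comp i h x y => .comp i h (x.map θ) (y.map θ)

theorem SymTerm.map_map_of_leftInverse {K : Type u} {E : Type v} {F : Type w} {θ : E → F}
    {η : F → E} (h : Function.LeftInverse η θ) {n : ℕ} (x : SymTerm K E n) :
    (x.map θ).map η = x := by
  induction x <;> simp_all [SymTerm.map, h _]

section

variable {K : Type u} [Field K] {E : Type v} [AddCommGroup E] [Module K E]
  {F : Type w} [AddCommGroup F] [Module K F]

/-- Substitution commutes with every constructor, so each clause of the congruence goes to the same
clause. Only the clauses on generators use something about `θ`: its linearity for `gen_add` and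
`gen_smul`, and `hθ` for `act_gen`. -/
theorem SymTerm.Rel.map {s : E →ₗ[K] E} {t : F →ₗ[K] F} (θ : E →ₗ[K] F)
    (hθ : ∀ e, θ (s e) = t (θ e)) {n : ℕ} {x y : SymTerm K E n} (h : SymTerm.Rel K s x y) :
    SymTerm.Rel K t (x.map θ) (y.map θ) := by
  induction h with
  | refl x => exact .refl _
  | symm _ ih => exact ih.symm
  | trans _ _ ih ih' => exact ih.trans ih'
  | add_congr _ _ ih ih' => exact .add_congr ih ih'
  | smul_congr c _ ih => exact .smul_congr c ih
  | act_congr σ _ ih => exact .act_congr σ ih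
  | comp_congr i h _ _ ih ih' => exact .comp_congr i h ih ih'
  | add_assoc x y z => exact .add_assoc _ _ _
  | add_comm x y => exact .add_comm _ _
  | zero_add x => exact .zero_add _
  | smul_add c x y => exact .smul_add _ _ _
  | add_smul c d x => exact .add_smul _ _ _
  | mul_smul c d x => exact .mul_smul _ _ _
  | one_smul x => exact .one_smul _
  | zero_smul x => exact .zero_smul _
  | gen_add e f => simpa only [SymTerm.map, map_add] using .gen_add _ _
  | gen_smul c e => simpa only [SymTerm.map, map_smul] using .gen_smul _ _
  | act_gen e => simpa only [SymTerm.map, hθ] using .act_gen _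
  | act_add σ x y => exact .act_add _ _ _
  | act_smul σ c x => exact .act_smul _ _ _
  | one_act x => exact .one_act _
  | mul_act σ τ x => exact .mul_act _ _ _
  | add_comp i h x x' y => exact .add_comp _ _ _ _ _
  | smul_comp i h c x y => exact .smul_comp _ _ _ _ _
  | comp_add i h x y y' => exact .comp_add _ _ _ _ _
  | comp_smul i h c x y => exact .comp_smul _ _ _ _ _
  | one_comp h x => exact .one_comp _ _
  | comp_one i h x => exact .comp_one _ _ _
  | comp_seq i j t hq hp hr hp' ht x y z => exact .comp_seq _ _ _ _ _ _ _ ht _ _ _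
  | comp_par i k t i' hq hp hr hp' hik ht hi' x y z =>
    exact .comp_par _ _ _ _ _ _ _ _ hik ht hi' _ _ _
  | act_comp i h σ τ x y => exact .act_comp _ _ _ _ _ _

/-- The isomorphism of free symmetric operads induced by an equivariant isomorphism of the spaces of
generators. -/
def SymFree.congr {s : E →ₗ[K] E} {t : F →ₗ[K] F} (θ : E ≃ₗ[K] F)
    (hθ : ∀ e, θ (s e) = t (θ e)) : SymOperad.Iso (SymFree K s) (SymFree K t) where
  toEquiv n :=
    { toFun := Quotient.map (SymTerm.map θ) (fun _ _ h => h.map θ.toLinearMap hθ)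
      invFun := Quotient.map (SymTerm.map θ.symm) (fun _ _ h => h.map θ.symm.toLinearMap
        (fun f => by simp [LinearEquiv.symm_apply_eq, hθ]))
      left_inv := fun a => by
        induction a using Quotient.inductionOn with | _ a
        exact congrArg (Quotient.mk _) (SymTerm.map_map_of_leftInverse θ.left_inv a)
      right_inv := fun a => by
        induction a using Quotient.inductionOn with | _ a
        exact congrArg (Quotient.mk _) (SymTerm.map_map_of_leftInverse θ.right_inv a)
      map_add' := fun a b => by
        induction a, b using Quotient.inductionOn₂ with | _ a b
        rfl
      map_smul' := fun c a => by
        induction a using Quotient.inductionOn with | _ a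
        rfl }
  map_one := rfl
  map_comp i h a b := by
    induction a, b using Quotient.inductionOn₂ with | _ a b
    rfl
  map_act σ a := by
    induction a using Quotient.inductionOn with | _ a
    rfl

theorem SymFree.congr_toFree {s : E →ₗ[K] E} {t : F →ₗ[K] F} (θ : E ≃ₗ[K] F)
    (hθ : ∀ e, θ (s e) = t (θ e)) (x : SymArityThree K E) :
    (SymFree.congr θ hθ).toEquiv 3 (SymArityThree.toFree K s x) =
      SymArityThree.toFree K t (fun k => TensorProduct.map θ.toLinearMap θ.toLinearMap (x k)) := by
  simp only [SymArityThree.toFree, LinearMap.sum_apply, map_sum, LinearMap.comp_apply,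
    LinearMap.proj_apply, (SymFree.congr θ hθ).map_act]
  refine Finset.sum_congr rfl fun k _ => congrArg _ ?_
  induction x k with
  | zero => simp
  | add y z hy hz => simp only [map_add, hy, hz]
  -- On a pure tensor both sides are the class of one and the same formal expression in `θ e` and `θ
  -- f`.
  | tmul e f => rfl

end

/-- An equivariant isomorphism of the spaces of generators that identifies the spaces of relations
induces an isomorphism of quadratic operads. -/
def SymQuadraticData.operadCongr {K : Type u} [Field K] (D : SymQuadraticData.{u, v} K)
    (D' : SymQuadraticData.{u, w} K) (θ : D.E ≃ₗ[K] D'.E) (hs : ∀ e, θ (D.s e) = D'.s (θ e))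
    (hrel : ∀ x : SymArityThree K D.E, x ∈ D.rel ↔
      (fun k => TensorProduct.map θ.toLinearMap θ.toLinearMap (x k)) ∈ D'.rel) :
    SymOperad.Iso D.operad D'.operad :=
  (SymFree.congr θ hs).quot _ _
    (fun _ _ hx => SymOperad.Ideal.map_mem_generate (SymFree.congr θ hs) (by
      rintro _ ⟨x, hx, rfl⟩
      exact ⟨_, (hrel x).1 hx, (SymFree.congr_toFree θ hs x).symm⟩) hx)
    (fun _ _ hy => SymOperad.Ideal.map_mem_generate (SymFree.congr θ hs).symm (by
      rintro _ ⟨y, hy, rfl⟩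
      -- `hrel` speaks of relations of the form `θ ⊗ θ` applied to something; this writes `y` in
      -- that form, which yields the converse inclusion of ideals through the inverse isomorphism.
      have hxy : (fun k => TensorProduct.map θ.toLinearMap θ.toLinearMap
          (TensorProduct.map θ.symm.toLinearMap θ.symm.toLinearMap (y k))) = y := by
        funext k
        rw [← LinearMap.comp_apply, ← TensorProduct.map_comp]
        simp
      refine ⟨fun k => TensorProduct.map θ.symm.toLinearMap θ.symm.toLinearMap (y k),
        (hrel _).2 (by rwa [hxy]), ?_⟩
      refine ((LinearEquiv.symm_apply_eq _).2 ?_).symm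
      rw [SymFree.congr_toFree, hxy]) hy)

/-! ### Relations of the nonsymmetric operads as graphs, and their orthogonals -/

section

variable {K : Type u} [Field K] {A : Type v} [AddCommGroup A] [Module K A]

/-- The space of relations of `As_Φ`. -/
noncomputable def asRel (Φ : A ⊗[K] A →ₗ[K] A ⊗[K] A) : Submodule K (NSArityThree K A) :=
  (asData Φ).rel

/-- The space of relations of `As'_Φ`. -/
noncomputable def asOppRel (Φ : A ⊗[K] A →ₗ[K] A ⊗[K] A) : Submodule K (NSArityThree K A) :=
  (asOppData Φ).rel

theorem mem_asRel {Φ : A ⊗[K] A →ₗ[K] A ⊗[K] A} {x : NSArityThree K A} :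
    x ∈ asRel Φ ↔ x.1 = -Φ x.2 := by
  constructor
  · intro hx
    refine Submodule.span_induction (p := fun x _ => x.1 = -Φ x.2) ?_ ?_ ?_ ?_ hx
    · rintro _ ⟨a, b, rfl⟩
      simp
    · simp
    · intro y z _ _ hy hz
      simp only [Prod.fst_add, Prod.snd_add, map_add, hy, hz, neg_add]
    · intro c y _ hy
      simp only [Prod.smul_fst, Prod.smul_snd, map_smul, hy, smul_neg]
  · obtain ⟨x₁, x₂⟩ := x
    rintro (rfl : x₁ = -Φ x₂)
    -- The defining relations depend linearly on `a ⊗ b` and pure tensors span, so the relation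
    -- attached to an arbitrary tensor also lies in the span.
    have hle : (⊤ : Submodule K (A ⊗[K] A)) ≤ (asRel Φ).comap
        (LinearMap.inr K (A ⊗[K] A) (A ⊗[K] A) - LinearMap.inl K (A ⊗[K] A) (A ⊗[K] A) ∘ₗ Φ) := by
      rw [← TensorProduct.span_tmul_eq_top, Submodule.span_le]
      rintro _ ⟨a, b, rfl⟩
      exact Submodule.subset_span ⟨a, b, rfl⟩
    have h := Submodule.mem_comap.1 (hle (Submodule.mem_top (x := x₂)))
    simpa using h

theorem mem_asOppRel {Φ : A ⊗[K] A →ₗ[K] A ⊗[K] A} {x : NSArityThree K A} :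
    x ∈ asOppRel Φ ↔ x.2 = -Φ x.1 := by
  constructor
  · intro hx
    refine Submodule.span_induction (p := fun x _ => x.2 = -Φ x.1) ?_ ?_ ?_ ?_ hx
    · rintro _ ⟨a, b, rfl⟩
      simp
    · simp
    · intro y z _ _ hy hz
      simp only [Prod.fst_add, Prod.snd_add, map_add, hy, hz, neg_add]
    · intro c y _ hy
      simp only [Prod.smul_fst, Prod.smul_snd, map_smul, hy, smul_neg]
  · obtain ⟨x₁, x₂⟩ := x
    rintro (rfl : x₂ = -Φ x₁)
    have hle : (⊤ : Submodule K (A ⊗[K] A)) ≤ (asOppRel Φ).comap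
        (LinearMap.inl K (A ⊗[K] A) (A ⊗[K] A) - LinearMap.inr K (A ⊗[K] A) (A ⊗[K] A) ∘ₗ Φ) := by
      rw [← TensorProduct.span_tmul_eq_top, Submodule.span_le]
      rintro _ ⟨a, b, rfl⟩
      exact Submodule.subset_span ⟨a, b, rfl⟩
    have h := Submodule.mem_comap.1 (hle (Submodule.mem_top (x := x₁)))
    simpa using h

theorem dualDistrib_transposeTensor [FiniteDimensional K A] (Φ : A ⊗[K] A →ₗ[K] A ⊗[K] A)
    (F : Module.Dual K A ⊗[K] Module.Dual K A) (x : A ⊗[K] A) :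
    TensorProduct.dualDistrib K A A (transposeTensor Φ F) x =
      TensorProduct.dualDistrib K A A F (Φ x) :=
  LinearMap.congr_fun ((TensorProduct.dualDistribEquiv K A A).apply_symm_apply _) x

/-- In finite dimension `A* ⊗ A*` is the dual of `A ⊗ A`, so an equation between its elements can be
tested by evaluation. This is the form in which orthogonality conditions arise. -/
theorem eq_neg_transposeTensor_iff [FiniteDimensional K A] (Φ : A ⊗[K] A →ₗ[K] A ⊗[K] A)
    (F G : Module.Dual K A ⊗[K] Module.Dual K A) :
    F = -transposeTensor Φ G ↔ ∀ x, TensorProduct.dualDistrib K A A F x =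
      -TensorProduct.dualDistrib K A A G (Φ x) := by
  rw [← (TensorProduct.dualDistribEquiv K A A).injective.eq_iff, LinearMap.ext_iff]
  refine forall_congr' fun x => ?_
  rw [← dualDistrib_transposeTensor]
  change _ = TensorProduct.dualDistrib K A A (-transposeTensor Φ G) x ↔ _
  rw [(map_neg (TensorProduct.dualDistrib K A A) (transposeTensor Φ G) :)]
  rfl

/-- The pairing of `(F₁, F₂)` with `(-Φ x, x)` is `-F₁(Φ x) - F₂(x)`, which vanishes for all `x` iff
`F₂ = -Φ* F₁`. -/
theorem asData_koszulDual [FiniteDimensional K A] (Φ : A ⊗[K] A →ₗ[K] A ⊗[K] A) :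
    (asData Φ).koszulDual = asOppData (transposeTensor Φ) := by
  have h : (asRel Φ).dualAnnihilator.comap (NSArityThree.pairing K A) =
      asOppRel (transposeTensor Φ) := by
    refine Submodule.ext fun F => ?_
    rw [mem_asOppRel, eq_neg_transposeTensor_iff]
    rw [Submodule.mem_comap, Submodule.mem_dualAnnihilator]
    constructor
    · intro hF x
      have h := hF (-Φ x, x) (mem_asRel.2 rfl)
      simp [NSArityThree.pairing] at h
      linear_combination -h
    · rintro hF ⟨x₁, x₂⟩ hx
      obtain rfl : x₁ = -Φ x₂ := mem_asRel.1 hx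
      simp [NSArityThree.pairing, hF]
  -- Both data have `A*` as generators by definition, so only the relations have to be compared.
  exact congrArg (fun R => (⟨Module.Dual K A, R⟩ : NSQuadraticData K)) h

/-- Here the pairing with `(x, -Φ x)` is `F₁(x) + F₂(Φ x)`. -/
theorem asOppData_koszulDual [FiniteDimensional K A] (Φ : A ⊗[K] A →ₗ[K] A ⊗[K] A) :
    (asOppData Φ).koszulDual = asData (transposeTensor Φ) := by
  have h : (asOppRel Φ).dualAnnihilator.comap (NSArityThree.pairing K A) =
      asRel (transposeTensor Φ) := by
    refine Submodule.ext fun F => ?_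
    rw [mem_asRel, eq_neg_transposeTensor_iff]
    rw [Submodule.mem_comap, Submodule.mem_dualAnnihilator]
    constructor
    · intro hF x
      have h := hF (x, -Φ x) (mem_asOppRel.2 rfl)
      simp [NSArityThree.pairing] at h
      linear_combination h
    · rintro hF ⟨x₁, x₂⟩ hx
      obtain rfl : x₂ = -Φ x₁ := mem_asOppRel.1 hx
      simp [NSArityThree.pairing, hF]
  exact congrArg (fun R => (⟨Module.Dual K A, R⟩ : NSQuadraticData K)) h

end

/-! ### Explicit action of the permutations of three letters -/

/-- On the integers modulo three, the even permutations are the translations `x ↦ x + k` and the odd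
ones the reflections `x ↦ k - x`. This makes the index of each summand after the action an explicit
sum or difference. -/
theorem perm_fin_three_eq (σ : Equiv.Perm (Fin 3)) :
    ∃ k, σ = Equiv.addRight k ∨ σ = Equiv.subLeft k := by
  revert σ
  decide

namespace SymArityThree

variable {K : Type u} [Field K] {E : Type v} [AddCommGroup E] [Module K E]

theorem act_addRight (s : E →ₗ[K] E) (k j : Fin 3) (G : SymArityThree K E) :
    act s (Equiv.addRight k) G j = G (j - k) := by
  have h : ∀ k : Fin 3, Equiv.Perm.sign (Equiv.addRight k) = 1 := by decide
  have h' : ∀ k j : Fin 3, (Equiv.addRight k)⁻¹ j = j - k := by decide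
  simp only [act, h, if_true, LinearMap.pi_apply, LinearMap.comp_apply, LinearMap.proj_apply, h',
    LinearMap.id_apply]

theorem act_subLeft (s : E →ₗ[K] E) (k j : Fin 3) (G : SymArityThree K E) :
    act s (Equiv.subLeft k) G j = s.lTensor E (G (k - j)) := by
  have h : ∀ k : Fin 3, ¬ Equiv.Perm.sign (Equiv.subLeft k) = 1 := by decide
  have h' : ∀ k j : Fin 3, (Equiv.subLeft k)⁻¹ j = k - j := by decide
  simp only [act, h, if_false, LinearMap.pi_apply, LinearMap.comp_apply, LinearMap.proj_apply, h']

theorem pairing_apply (F : SymArityThree K (Module.Dual K E)) (G : SymArityThree K E) :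
    pairing K E F G = ∑ k, TensorProduct.dualDistrib K E E (F k) (G k) := by
  simp [pairing]

end SymArityThree

/-! ### Relations of the symmetric operad as a graph, and their orthogonal -/

section

variable {K : Type u} [Field K] {A : Type v} [AddCommGroup A] [Module K A]

/-- With `f` and `g` among `inl` and `inr`, this turns evaluation on one block of `(A × A) ⊗ (A ×
A)` into evaluation of the corresponding block of `F`. -/
theorem dualDistrib_map {B : Type w} [AddCommGroup B] [Module K B] (f g : A →ₗ[K] B)
    (F : Module.Dual K B ⊗[K] Module.Dual K B) (x : A ⊗[K] A) :
    TensorProduct.dualDistrib K B B F (TensorProduct.map f g x) =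
      TensorProduct.dualDistrib K A A (TensorProduct.map f.dualMap g.dualMap F) x := by
  induction F with
  | zero => simp
  | add F G hF hG => simp only [map_add, LinearMap.add_apply, hF, hG]
  | tmul φ ψ =>
    induction x with
    | zero => simp
    | add x y hx hy => simp only [map_add, hx, hy]
    | tmul a b => rfl

/-- The defining relation `comp₂ (a ⊗ b) - comp₁ (Φ (a ⊗ b))` of `Sym As_Φ`, as a linear function
of `a ⊗ b`. -/
noncomputable def symAsRelator (Φ : A ⊗[K] A →ₗ[K] A ⊗[K] A) :
    A ⊗[K] A →ₗ[K] SymArityThree K (A × A) :=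
  SymArityThree.comp₂ (LinearEquiv.prodComm K A A).toLinearMap ∘ₗ
      TensorProduct.map (LinearMap.inl K A A) (LinearMap.inl K A A)
    - SymArityThree.comp₁ ∘ₗ TensorProduct.map (LinearMap.inl K A A) (LinearMap.inl K A A) ∘ₗ Φ

/-- The product `x₀ *_a (x₁ *_b x₂)` is the opposite product of `a` applied to `x₁ *_b x₂` and `x₀`,
hence an outer factor `inr` in the copy with index 0. -/
theorem symAsRelator_zero (Φ : A ⊗[K] A →ₗ[K] A ⊗[K] A) (x : A ⊗[K] A) :
    symAsRelator Φ x 0 = TensorProduct.map (LinearMap.inr K A A) (LinearMap.inl K A A) x := by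
  have h : (LinearEquiv.prodComm K A A).toLinearMap ∘ₗ LinearMap.inl K A A =
    LinearMap.inr K A A := rfl
  simp only [symAsRelator, SymArityThree.comp₂, SymArityThree.comp₁, LinearMap.sub_apply,
    LinearMap.comp_apply, Pi.sub_apply]
  rw [← LinearMap.comp_apply (LinearMap.rTensor _ _), LinearMap.rTensor_comp_map, h]
  simp

theorem symAsRelator_one (Φ : A ⊗[K] A →ₗ[K] A ⊗[K] A) (x : A ⊗[K] A) :
    symAsRelator Φ x 1 = 0 := by
  simp [symAsRelator, SymArityThree.comp₂, SymArityThree.comp₁]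

theorem symAsRelator_two (Φ : A ⊗[K] A →ₗ[K] A ⊗[K] A) (x : A ⊗[K] A) :
    symAsRelator Φ x 2 =
      -TensorProduct.map (LinearMap.inl K A A) (LinearMap.inl K A A) (Φ x) := by
  simp [symAsRelator, SymArityThree.comp₂, SymArityThree.comp₁]

theorem lTensor_prodComm_map (f : A →ₗ[K] A × A) (x : A ⊗[K] A) :
    (LinearEquiv.prodComm K A A).toLinearMap.lTensor (A × A)
      (TensorProduct.map f (LinearMap.inl K A A) x) =
      TensorProduct.map f (LinearMap.inr K A A) x := by
  rw [← LinearMap.comp_apply, LinearMap.lTensor_comp_map]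
  rfl

theorem act_addRight_symAsRelator (Φ : A ⊗[K] A →ₗ[K] A ⊗[K] A) (k j : Fin 3) (x : A ⊗[K] A) :
    SymArityThree.act (LinearEquiv.prodComm K A A).toLinearMap (Equiv.addRight k)
        (symAsRelator Φ x) j =
      if j = k then TensorProduct.map (LinearMap.inr K A A) (LinearMap.inl K A A) x
      else if j = k + 2 then -TensorProduct.map (LinearMap.inl K A A) (LinearMap.inl K A A) (Φ x)
      else 0 := by
  rw [SymArityThree.act_addRight]
  -- Only the difference of `j` and `k` matters: three cases instead of nine.
  obtain ⟨l, rfl⟩ : ∃ l, j = k + l := ⟨j - k, by simp⟩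
  rw [add_sub_cancel_left]
  fin_cases l <;> simp [symAsRelator_zero, symAsRelator_one, symAsRelator_two]

/-- A reflection sends the copies 0 and 2 to `k` and `k - 2 = k + 1`. Being odd, it also flips the
inner generator, from `inl` to `inr`. -/
theorem act_subLeft_symAsRelator (Φ : A ⊗[K] A →ₗ[K] A ⊗[K] A) (k j : Fin 3) (x : A ⊗[K] A) :
    SymArityThree.act (LinearEquiv.prodComm K A A).toLinearMap (Equiv.subLeft k)
        (symAsRelator Φ x) j =
      if j = k then TensorProduct.map (LinearMap.inr K A A) (LinearMap.inr K A A) x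
      else if j = k + 1 then -TensorProduct.map (LinearMap.inl K A A) (LinearMap.inr K A A) (Φ x)
      else 0 := by
  rw [SymArityThree.act_subLeft]
  obtain ⟨l, rfl⟩ : ∃ l, j = k - l := ⟨k - j, by simp⟩
  have h : ∀ k : Fin 3, k - 2 = k + 1 ∧ ¬ k - 1 = k + 1 := by decide
  rw [sub_sub_cancel]
  fin_cases l
  · simp only [Fin.zero_eta, symAsRelator_zero, sub_zero, lTensor_prodComm_map, if_true]
  · simp [symAsRelator_one, h]
  · simp only [Fin.reduceFinMk, symAsRelator_two, (h k).1, map_neg, lTensor_prodComm_map]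
    simp

/-- The space of relations of `Sym As_Φ`. -/
noncomputable def symAsRel (Φ : A ⊗[K] A →ₗ[K] A ⊗[K] A) : Submodule K (SymArityThree K (A × A)) :=
  (symAsData Φ).rel

theorem act_symAsRelator_mem (Φ : A ⊗[K] A →ₗ[K] A ⊗[K] A) (σ : Equiv.Perm (Fin 3))
    (x : A ⊗[K] A) :
    SymArityThree.act (LinearEquiv.prodComm K A A).toLinearMap σ (symAsRelator Φ x) ∈
      symAsRel Φ := by
  induction x with
  | zero => simp
  | add x y hx hy => simpa only [map_add] using Submodule.add_mem _ hx hy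
  | tmul a b => exact Submodule.subset_span ⟨σ, a, b, rfl⟩

theorem symAsRel_le {Φ : A ⊗[K] A →ₗ[K] A ⊗[K] A} {S : Submodule K (SymArityThree K (A × A))}
    (h : ∀ k x,
      SymArityThree.act (LinearEquiv.prodComm K A A).toLinearMap (Equiv.addRight k)
        (symAsRelator Φ x) ∈ S ∧
      SymArityThree.act (LinearEquiv.prodComm K A A).toLinearMap (Equiv.subLeft k)
        (symAsRelator Φ x) ∈ S) :
    symAsRel Φ ≤ S := by
  refine Submodule.span_le.2 ?_
  rintro _ ⟨σ, a, b, rfl⟩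
  obtain ⟨k, rfl | rfl⟩ := perm_fin_three_eq σ
  · exact (h k (a ⊗ₜ b)).1
  · exact (h k (a ⊗ₜ b)).2

theorem prod_tensor_decomposition (x : (A × A) ⊗[K] (A × A)) :
    x = TensorProduct.map (.inl K A A) (.inl K A A) (TensorProduct.map (.fst K A A) (.fst K A A) x)
      + TensorProduct.map (.inl K A A) (.inr K A A) (TensorProduct.map (.fst K A A) (.snd K A A) x)
      + TensorProduct.map (.inr K A A) (.inl K A A) (TensorProduct.map (.snd K A A) (.fst K A A) x)
      + TensorProduct.map (.inr K A A) (.inr K A A)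
        (TensorProduct.map (.snd K A A) (.snd K A A) x) := by
  induction x with
  | zero => simp
  | add x y hx hy =>
    simp only [map_add]
    nth_rewrite 1 [hx]
    nth_rewrite 1 [hy]
    abel
  | tmul a b =>
    obtain ⟨a, a'⟩ := a
    obtain ⟨b, b'⟩ := b
    simp only [TensorProduct.map_tmul, LinearMap.fst_apply, LinearMap.snd_apply,
      LinearMap.inl_apply, LinearMap.inr_apply]
    rw [add_assoc, ← TensorProduct.tmul_add, ← TensorProduct.tmul_add, ← TensorProduct.add_tmul]
    simp

/-- The space of solutions of the linear equations that cut out the relations of `Sym As_Φ`. -/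
def symAsSolutions (Φ : A ⊗[K] A →ₗ[K] A ⊗[K] A) : Submodule K (SymArityThree K (A × A)) where
  carrier := {G | ∀ k,
    TensorProduct.map (.fst K A A) (.fst K A A) (G k) =
      -Φ (TensorProduct.map (.snd K A A) (.fst K A A) (G (k + 1))) ∧
    TensorProduct.map (.fst K A A) (.snd K A A) (G (k + 1)) =
      -Φ (TensorProduct.map (.snd K A A) (.snd K A A) (G k))}
  zero_mem' := by simp
  add_mem' {G G'} hG hG' k := by
    simp only [Pi.add_apply, map_add, (hG k).1, (hG k).2, (hG' k).1, (hG' k).2, neg_add, and_self]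
  smul_mem' c G hG k := by
    simp only [Pi.smul_apply, map_smul, (hG k).1, (hG k).2, smul_neg, and_self]

/-- Each of the six families of relations contains a single outer-inr block, with coefficient one,
and every such block occurs in exactly one family. The relations are therefore the graph of a map
from the outer-inr blocks to the outer-inl blocks. -/
theorem symAsRel_eq (Φ : A ⊗[K] A →ₗ[K] A ⊗[K] A) : symAsRel Φ = symAsSolutions Φ := by
  have e (f g : A × A →ₗ[K] A) (f' g' : A →ₗ[K] A × A) (x : A ⊗[K] A) :
      TensorProduct.map f g (TensorProduct.map f' g' x) =
        TensorProduct.map (f ∘ₗ f') (g ∘ₗ g') x := by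
    rw [TensorProduct.map_comp, LinearMap.comp_apply]
  refine le_antisymm (symAsRel_le fun k x => ⟨fun j => ?_, fun j => ?_⟩) fun G hG => ?_
  · simp only [act_addRight_symAsRelator]
    fin_cases k <;> fin_cases j <;> simp [e]
  · simp only [act_subLeft_symAsRelator]
    fin_cases k <;> fin_cases j <;> simp [e]
  -- The coefficients are forced: the inr-inl block of `G k` comes only from the translation by `k`,
  -- its inr-inr block only from the reflection `x ↦ k - x`.
  · have h : G = ∑ k, (SymArityThree.act (LinearEquiv.prodComm K A A).toLinearMap
          (Equiv.addRight k)
          (symAsRelator Φ (TensorProduct.map (.snd K A A) (.fst K A A) (G k))) +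
        SymArityThree.act (LinearEquiv.prodComm K A A).toLinearMap (Equiv.subLeft k)
          (symAsRelator Φ (TensorProduct.map (.snd K A A) (.snd K A A) (G k)))) := by
      funext j
      -- The equation at `l` determines the inl-inr block of `G (l + 1)`, whereas the inl-inl block
      -- of `G (l + 1)` is given by the equation at `l + 1`.
      obtain ⟨l, rfl⟩ : ∃ l, j = l + 1 := ⟨j - 1, by simp⟩
      rw [prod_tensor_decomposition (G (l + 1)), (hG (l + 1)).1, (hG l).2]
      simp only [Finset.sum_apply, Pi.add_apply, act_addRight_symAsRelator,
        act_subLeft_symAsRelator, Fin.sum_univ_three]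
      fin_cases l <;> simp <;> abel
    rw [h]
    exact Submodule.sum_mem _ fun k _ => Submodule.add_mem _ (act_symAsRelator_mem _ _ _)
      (act_symAsRelator_mem _ _ _)

/-- Each block acquires one sign for every `-g` in it. In both equations these cancel against the
sign of `-Φ`. The case of interest has `f` and `g` equal to restriction along `inr` and `inl`. -/
theorem map_prod_neg_mem_symAsRel {M : Type w} [AddCommGroup M] [Module K M]
    {Φ : A ⊗[K] A →ₗ[K] A ⊗[K] A} (f g : M →ₗ[K] A) (F : SymArityThree K M) :
    (fun k => TensorProduct.map (f.prod (-g)) (f.prod (-g)) (F k)) ∈ symAsRel Φ ↔ ∀ k,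
      TensorProduct.map f f (F k) = Φ (TensorProduct.map g f (F (k + 1))) ∧
      TensorProduct.map f g (F (k + 1)) = Φ (TensorProduct.map g g (F k)) := by
  have e (p q : A × A →ₗ[K] A) (x : M ⊗[K] M) :
      TensorProduct.map p q (TensorProduct.map (f.prod (-g)) (f.prod (-g)) x) =
        TensorProduct.map (p ∘ₗ f.prod (-g)) (q ∘ₗ f.prod (-g)) x := by
    rw [TensorProduct.map_comp, LinearMap.comp_apply]
  have hl (p q : M →ₗ[K] A) (x : M ⊗[K] M) :
      TensorProduct.map (-p) q x = -TensorProduct.map p q x := by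
    rw [← neg_one_smul K p, TensorProduct.map_smul_left, LinearMap.smul_apply, neg_one_smul]
  have hr (p q : M →ₗ[K] A) (x : M ⊗[K] M) :
      TensorProduct.map p (-q) x = -TensorProduct.map p q x := by
    rw [← neg_one_smul K q, TensorProduct.map_smul_right, LinearMap.smul_apply, neg_one_smul]
  rw [symAsRel_eq]
  refine forall_congr' fun k => ?_
  simp only [e, LinearMap.fst_prod, LinearMap.snd_prod, hl, hr, map_neg, neg_neg, neg_inj]

/-- Every permuted relation lives in two blocks only, so its pairing with `F` compares one block of
`F` with the transpose `Φ*` of another. The odd permutations give the first equation, the even ones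
the second. -/
theorem mem_symAsRel_orthogonal [FiniteDimensional K A] {Φ : A ⊗[K] A →ₗ[K] A ⊗[K] A}
    {F : SymArityThree K (Module.Dual K (A × A))} :
    F ∈ (symAsRel Φ).dualAnnihilator.comap (SymArityThree.pairing K (A × A)) ↔ ∀ k,
      TensorProduct.map (LinearMap.inr K A A).dualMap (LinearMap.inr K A A).dualMap (F k) =
        transposeTensor Φ (TensorProduct.map (LinearMap.inl K A A).dualMap
          (LinearMap.inr K A A).dualMap (F (k + 1))) ∧
      TensorProduct.map (LinearMap.inr K A A).dualMap (LinearMap.inl K A A).dualMap (F (k + 1)) =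
        transposeTensor Φ (TensorProduct.map (LinearMap.inl K A A).dualMap
          (LinearMap.inl K A A).dualMap (F k)) := by
  have hodd (k : Fin 3) (x : A ⊗[K] A) : SymArityThree.pairing K (A × A) F
      (SymArityThree.act (LinearEquiv.prodComm K A A).toLinearMap (Equiv.subLeft k)
        (symAsRelator Φ x)) =
      TensorProduct.dualDistrib K A A (TensorProduct.map (LinearMap.inr K A A).dualMap
        (LinearMap.inr K A A).dualMap (F k) - transposeTensor Φ (TensorProduct.map
          (LinearMap.inl K A A).dualMap (LinearMap.inr K A A).dualMap (F (k + 1)))) x := by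
    rw [map_sub, LinearMap.sub_apply, dualDistrib_transposeTensor, SymArityThree.pairing_apply,
      Fin.sum_univ_three]
    simp only [act_subLeft_symAsRelator]
    fin_cases k <;> simp [dualDistrib_map] <;> ring
  -- The translation by `k + 1` is used because it involves the copies `k + 1` and `(k + 1) + 2 =
  -- k`, the same two as in `hodd k`.
  have heven (k : Fin 3) (x : A ⊗[K] A) : SymArityThree.pairing K (A × A) F
      (SymArityThree.act (LinearEquiv.prodComm K A A).toLinearMap (Equiv.addRight (k + 1))
        (symAsRelator Φ x)) =
      TensorProduct.dualDistrib K A A (TensorProduct.map (LinearMap.inr K A A).dualMap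
        (LinearMap.inl K A A).dualMap (F (k + 1)) - transposeTensor Φ (TensorProduct.map
          (LinearMap.inl K A A).dualMap (LinearMap.inl K A A).dualMap (F k))) x := by
    rw [map_sub, LinearMap.sub_apply, dualDistrib_transposeTensor, SymArityThree.pairing_apply,
      Fin.sum_univ_three]
    simp only [act_addRight_symAsRelator]
    fin_cases k <;> simp [dualDistrib_map] <;> ring
  have hinj (F G : Module.Dual K A ⊗[K] Module.Dual K A)
      (h : ∀ x, TensorProduct.dualDistrib K A A (F - G) x = 0) : F = G :=
    sub_eq_zero.1 ((TensorProduct.dualDistribEquiv K A A).map_eq_zero_iff.1 (LinearMap.ext h))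
  rw [Submodule.mem_comap, Submodule.mem_dualAnnihilator]
  constructor
  · exact fun h k =>
      ⟨hinj _ _ fun x => (hodd k x).symm.trans (h _ (act_symAsRelator_mem _ _ _)),
        hinj _ _ fun x => (heven k x).symm.trans (h _ (act_symAsRelator_mem _ _ _))⟩
  · intro h
    refine symAsRel_le (S := LinearMap.ker (SymArityThree.pairing K (A × A) F))
      fun k x => ⟨?_, ?_⟩
    · obtain ⟨k, rfl⟩ : ∃ l, k = l + 1 := ⟨k - 1, by simp⟩
      rw [LinearMap.mem_ker, heven, sub_eq_zero.2 (h k).2, map_zero, LinearMap.zero_apply]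
    · rw [LinearMap.mem_ker, hodd, sub_eq_zero.2 (h k).1, map_zero, LinearMap.zero_apply]

/-! ### The twist of the generators and the Koszul duals -/

variable (K A) in
/-- The isomorphism `(A × A)* ≃ A* × A*` that sends `φ` to `(φ ∘ inr, -φ ∘ inl)`. It exchanges the
opposite of the transpose of the flip with the flip. -/
noncomputable def dualProdTwist :
    Module.Dual K (A × A) ≃ₗ[K] Module.Dual K A × Module.Dual K A :=
  LinearEquiv.ofLinearMap
    ((LinearMap.inr K A A).dualMap.prod (-(LinearMap.inl K A A).dualMap))
    ((LinearMap.snd K A A).dualMap.coprod (-(LinearMap.fst K A A).dualMap))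
    (by
      refine LinearMap.ext fun x => Prod.ext (LinearMap.ext fun a => ?_) (LinearMap.ext fun a => ?_)
      all_goals simp)
    (by
      refine LinearMap.ext fun φ => LinearMap.ext fun x => ?_
      simp [← map_add])

theorem symAsData_koszulDual_iso [FiniteDimensional K A] (Φ : A ⊗[K] A →ₗ[K] A ⊗[K] A) :
    Nonempty (SymOperad.Iso (symAsData Φ).koszulDual.operad (SymAs (transposeTensor Φ))) := by
  have hrel (F : SymArityThree K (Module.Dual K (A × A))) :
      F ∈ (symAsRel Φ).dualAnnihilator.comap (SymArityThree.pairing K (A × A)) ↔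
        (fun k => TensorProduct.map (dualProdTwist K A).toLinearMap
          (dualProdTwist K A).toLinearMap (F k)) ∈ symAsRel (transposeTensor Φ) :=
    mem_symAsRel_orthogonal.trans (map_prod_neg_mem_symAsRel _ _ F).symm
  exact ⟨SymQuadraticData.operadCongr (symAsData Φ).koszulDual (symAsData (transposeTensor Φ))
    -- Equivariance: the sign of the dual action and the sign in the second component of the twist
    -- compose to `neg_neg` there, while the first components agree by definition.
    (dualProdTwist K A) (fun φ => Prod.ext rfl (LinearMap.ext fun a => neg_neg _)) hrel⟩

end

theorem proposition3p6 {K : Type u} [Field K] {A : Type v} [AddCommGroup A] [Module K A]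
    [FiniteDimensional K A] (Φ : A ⊗[K] A →ₗ[K] A ⊗[K] A) (hΦ : IsLinearEAS Φ) :
    Nonempty (NSOperad.Iso (asData Φ).koszulDual.operad (AsOpp (transposeTensor Φ))) ∧
    Nonempty (NSOperad.Iso (asOppData Φ).koszulDual.operad (As (transposeTensor Φ))) ∧
    Nonempty (SymOperad.Iso (symAsData Φ).koszulDual.operad (SymAs (transposeTensor Φ))) := by
  refine ⟨?_, ?_, symAsData_koszulDual_iso Φ⟩
  · rw [asData_koszulDual]
    exact ⟨NSOperad.Iso.refl _⟩
  · rw [asOppData_koszulDual]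
    exact ⟨NSOperad.Iso.refl _⟩
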